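/- For $\tau>0$ put $$f(z)=1+\tfrac14 z^{-5/2},\qquad \varphi(z,\tau)=-\pi z-\frac{\pi}{4z}+\tfrac12\bigl(\tfrac12+2\pi i\tau^{-2}\bigr)\log(1-iz),$$ on $\mathbf C\smallsetminus(-i)[0,\infty)$, where $z^{-5/2}$ is taken with $\arg z\in(-\frac\pi2,\frac{3\pi}2]$ and $\log(1-iz)$ is the principal logarithm. Let $\epsilon=e^{\pi i/4}$. For all sufficiently small $\tau>0$ the cubic polynomial $$P(z,\tau)=z^3+\bigl(i-\tfrac1{4\pi}-i\tau^{-2}\bigr)z^2-\tfrac z4-\tfrac i4$$ has exactly one zero $q_1=q_1(\tau)$ with $\bigl|q_1-\bigl(i\tau^{-2}+\tfrac1{4\pi}-i\bigr)\bigr|\le\tau^2/2$, and $\varphi'(q_1,\tau)=0$ (the main saddle). Put $q_1=i\tau^{-2}Q_1(\tau)$, $$J_4(\tau)=2\pi\int_{q_1-\frac12\epsilon\tau^{-2}}^{q_1+\frac12\epsilon\tau^{-2}}f(z)e^{\varphi(z,\tau)}\,dz$$ (integral along the segment), and $$A_n(\tau)=(Q_1+\tau^2)^{-n}\Bigl(1+\frac{\tau^2}{4\pi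 i}\Bigr)-\frac{n\tau^4}{4Q_1^{n+1}},\qquad B_n(\tau)=Q_1^{-5/2-n},$$ and define $E(\tau)$ by $$e^{\varphi(q_1,\tau)}=-\frac1{\sqrt\tau}\exp\Bigl\{i\,\frac{-2\pi\log\tau-\pi}{\tau^2}\Bigr\}E(\tau).$$ Let $C_m(y)=C_m(y;\tau)$ be the polynomial in $y$ which is the coefficient of $u^m$ in $$\Bigl(1+\frac{\epsilon^3}{4}u^5\sum_{n\ge0}\binom{-5/2}{n}B_n\epsilon^{-n}u^ny^n\Bigr)\exp\Bigl(-\pi i\sum_{n\ge3}\frac{A_n}{n}\epsilon^{3n}u^{n-2}y^n\Bigr),$$ and let $F_m(\tau)$ be obtained from $C_m$ by replacing each $y^n$ by the normalised Gaussian moment $\bigl(\frac{2}{\pi A_2}\bigr)^{n/2}\Gamma(\frac{n+1}2)/\sqrt\pi$ if $n$ is even, and by $0$ if $n$ is odd. Then the following hold. 1. For small $\tau>0$, the functions $E$, $A_n$ ($n\ge2$) and $B_n$ ($n\ge0$) are sums of convergent power series in $\tau$ with constant term $1$; for $n\ge 2$, $A_n=\varphi^{(n)}(q_1,\tau)/\bigl(\pi(i\tau^2)^{n-1}(n-1)!\bigr)$;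 and, as $\tau\to0^+$, $$E(\tau)=1+\frac{i(8\pi^2-1)\tau^2}{32\pi}+\Bigl(-\frac7{128}+\frac{13}{6144\pi^2}+\frac{i\pi}4-\frac{\pi^2}{32}\Bigr)\tau^4+O(\tau^5),$$ $$A_2=1+\frac{i\tau^2}{4\pi}-\frac{\tau^4}{16\pi^2}+\Bigl(-\frac12-\frac{i}{64\pi^3}\Bigr)\tau^6+\frac1{256}\Bigl(-400+\frac1{\pi^4}-\frac{128i}{\pi}\Bigr)\tau^8+O(\tau^{10}).$$ 2. For all $\tau>0$, $F_0=1$, $F_1=F_3=0$, $$F_2=\frac{3iA_4}{4\pi A_2^2}-\frac{5iA_3^2}{6\pi A_2^3},$$ $$F_4=-\frac{385A_3^4}{72\pi^2A_2^6}+\frac{105A_4A_3^2}{8\pi^2A_2^5}-\frac{7A_5A_3}{\pi^2A_2^4}-\frac{105A_4^2}{32\pi^2A_2^4}+\frac{5A_6}{2\pi^2A_2^3},\qquad F_5=\frac{\epsilon^3}{4}B_0.$$ 3. As $\tau\to0^+$, $J_4$ has the generalised asymptotic expansion $$J_4(\tau)\asymp-2\pi\sqrt2\,\tau^{-3/2}\exp\Bigl\{i\Bigl(\frac{-2\pi\log\tau-\pi}{\tau^2}+\frac\pi4\Bigr)\Bigr\}\frac{E(\tau)F(\tau)}{\sqrt{A_2}},\qquad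 F(\tau)\asymp\sum_{m\ge0}F_m(\tau)\tau^m,$$ with the principal square root; that is, for every $N\ge0$, $$J_4(\tau)=-2\pi\sqrt2\,\tau^{-3/2}\exp\Bigl\{i\Bigl(\frac{-2\pi\log\tau-\pi}{\tau^2}+\frac\pi4\Bigr)\Bigr\}\frac{E(\tau)}{\sqrt{A_2(\tau)}}\sum_{m=0}^{N-1}F_m(\tau)\tau^m+O\bigl(\tau^{N-3/2}\bigr).$$ -/

import Mathlib

open Filter Topology Asymptotics

noncomputable section

namespace SaddleJ

/-- The direction `ε = e^{π i / 4}`. -/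
def eps : ℂ := Complex.exp (Real.pi * Complex.I / 4)

/-- The branch of the logarithm on `ℂ ∖ (-i)[0, ∞)` with argument in `(-π/2, 3π/2]`. -/
def logCut (z : ℂ) : ℂ := Complex.log (-Complex.I * z) + Real.pi * Complex.I / 2

/-- `f(z) = 1 + z^{-5/2} / 4`, with the power taken with the branch `logCut`. -/
def amp (z : ℂ) : ℂ := 1 + 1 / 4 * Complex.exp (-(5 / 2) * logCut z)

/-- `φ(z, τ) = -π z - π / (4 z) + (1/2) (1/2 + 2 π i τ⁻²) log (1 - i z)`.  The function
`log (1 - i z)` with the principal logarithm is holomorphic on `ℂ ∖ (-i)[0, ∞)`. -/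
def phase (τ : ℝ) (z : ℂ) : ℂ :=
  -Real.pi * z - Real.pi / (4 * z)
    + (1 / 2 + 2 * Real.pi * Complex.I / (τ : ℂ) ^ 2) / 2 * Complex.log (1 - Complex.I * z)

/-- The cubic `P(z, τ)` whose zeros are the saddle points of `φ(·, τ)`. -/
def saddlePoly (τ : ℝ) (z : ℂ) : ℂ :=
  z ^ 3 + (Complex.I - 1 / (4 * Real.pi) - Complex.I / (τ : ℂ) ^ 2) * z ^ 2
    - z / 4 - Complex.I / 4

/-- `z` is a zero of `P(·, τ)` in the disc of radius `τ² / 2` around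
`i τ⁻² + 1/(4π) - i`. -/
def IsMainSaddle (τ : ℝ) (z : ℂ) : Prop :=
  saddlePoly τ z = 0 ∧
    ‖z - (Complex.I / (τ : ℂ) ^ 2 + 1 / (4 * Real.pi) - Complex.I)‖ ≤ τ ^ 2 / 2

/-- The main saddle `q₁(τ)`. -/
def q₁ (τ : ℝ) : ℂ := Classical.epsilon (IsMainSaddle τ)

/-- `Q₁(τ)`, determined by `q₁ = i τ⁻² Q₁`. -/
def Q₁ (τ : ℝ) : ℂ := -Complex.I * (τ : ℂ) ^ 2 * q₁ τ

/-- The integral of `g` along the oriented segment from `a` to `b`. -/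
def segmentIntegral (g : ℂ → ℂ) (a b : ℂ) : ℂ :=
  ∫ s in (0 : ℝ)..1, g (a + (s : ℂ) * (b - a)) * (b - a)

/-- The left end point `q₁⁻` of the segment through `q₁`. -/
def q₁Minus (τ : ℝ) : ℂ := q₁ τ - 1 / 2 * eps / (τ : ℂ) ^ 2

/-- The right end point `q₁⁺` of the segment through `q₁`. -/
def q₁Plus (τ : ℝ) : ℂ := q₁ τ + 1 / 2 * eps / (τ : ℂ) ^ 2

/-- `J₄(τ) = 2π ∫ f(z) e^{φ(z, τ)} dz` along the segment from `q₁⁻` to `q₁⁺`. -/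
def J₄ (τ : ℝ) : ℂ :=
  2 * Real.pi *
    segmentIntegral (fun z => amp z * Complex.exp (phase τ z)) (q₁Minus τ) (q₁Plus τ)

/-- `E(τ)`, defined by
`e^{φ(q₁, τ)} = -τ^{-1/2} exp (i (-2 π log τ - π) / τ²) E(τ)`. -/
def E (τ : ℝ) : ℂ :=
  -(Real.sqrt τ : ℂ)
    * Complex.exp (-(Complex.I * ((-2 * Real.pi * Real.log τ - Real.pi) / (τ : ℂ) ^ 2)))
    * Complex.exp (phase τ (q₁ τ))

/-- `A_n(τ) = (Q₁ + τ²)^{-n} (1 + τ² / (4 π i)) - n τ⁴ / (4 Q₁^{n+1})`. -/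
def A (n : ℕ) (τ : ℝ) : ℂ :=
  (1 + (τ : ℂ) ^ 2 / (4 * Real.pi * Complex.I)) / (Q₁ τ + (τ : ℂ) ^ 2) ^ n
    - n * (τ : ℂ) ^ 4 / (4 * Q₁ τ ^ (n + 1))

/-- `B_n(τ) = Q₁^{-5/2-n}` (principal power; `Q₁` is close to `1`), the normalised Taylor
coefficients of `z^{-5/2}` at `q₁`. -/
def B (n : ℕ) (τ : ℝ) : ℂ := Q₁ τ ^ (-(5 / 2) - (n : ℂ) : ℂ)

/-- The amplitude after the substitution `z = q₁ + ε τ⁻² x`, `x = τ y`, as a power series in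
`u`, where `u` stands for the explicit powers of `τ` (those inside `B_n` are kept):
`1 + (ε³ / 4) u⁵ ∑_n binom(-5/2, n) B_n ε^{-n} uⁿ yⁿ`.
Its coefficients are polynomials in `y`. -/
def ampSeries (τ : ℝ) : PowerSeries (Polynomial ℂ) :=
  PowerSeries.mk fun j =>
    if j = 0 then 1
    else if 5 ≤ j then
      Polynomial.C
        (eps ^ 3 / 4 * Ring.choose (-(5 / 2) : ℂ) (j - 5) * B (j - 5) τ / eps ^ (j - 5))
        * Polynomial.X ^ (j - 5)
    else 0

/-- The non-quadratic part of the exponent after the same substitution,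
`-π i ∑_{n ≥ 3} (A_n / n) ε^{3n} u^{n-2} yⁿ`; the quadratic part is `-π A₂ y² / 2`. -/
def phaseSeries (τ : ℝ) : PowerSeries (Polynomial ℂ) :=
  PowerSeries.mk fun j =>
    if j = 0 then 0
    else
      Polynomial.C
        (-(Real.pi * Complex.I) * A (j + 2) τ * eps ^ (3 * (j + 2)) / ((j : ℂ) + 2))
        * Polynomial.X ^ (j + 2)

/-- The coefficient of `u^m`, a polynomial in `y`, of `ampSeries * exp phaseSeries`.  As
`phaseSeries` has no constant term, its powers beyond the `m`-th do not contribute. -/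
def expansionCoeff (τ : ℝ) (m : ℕ) : Polynomial ℂ :=
  PowerSeries.coeff m
    (ampSeries τ * ∑ k ∈ Finset.range (m + 1),
      PowerSeries.C (Polynomial.C (1 / (k.factorial : ℂ))) * phaseSeries τ ^ k)

/-- The normalised Gaussian moment
`∫_ℝ yⁿ e^{-π A₂ y² / 2} dy / ∫_ℝ e^{-π A₂ y² / 2} dy`
`= (2 / (π A₂))^{n/2} Γ((n+1)/2) / √π` for even `n`, and `0` for odd `n`. -/
def moment (τ : ℝ) (n : ℕ) : ℂ :=
  if Even n then
    (2 / (Real.pi * A 2 τ)) ^ (n / 2) * (Real.Gamma (((n : ℝ) + 1) / 2) / Real.sqrt Real.pi : ℝ)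
  else 0

/-- The coefficient `F_m(τ)` of `τ^m` in the generalised expansion of `F(τ)`: term by term
integration of the polynomial `expansionCoeff τ m` against the Gaussian. -/
def Fcoeff (m : ℕ) (τ : ℝ) : ℂ :=
  (expansionCoeff τ m).sum fun n c => c * moment τ n

/-- `h`, on some interval `(0, δ)`, is the sum of a convergent power series in `τ` with
constant term `c`. -/
def IsPowerSeriesNearZero (h : ℝ → ℂ) (c : ℂ) : Prop :=
  ∃ g : ℂ → ℂ, AnalyticAt ℂ g 0 ∧ g 0 = c ∧ ∀ᶠ τ : ℝ in 𝓝[>] 0, h τ = g (τ : ℂ)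

/-- The factor
`-2π√2 τ^{-3/2} exp {i ((-2π log τ - π)/τ² + π/4)} E(τ) / √A₂` in front of `F(τ)`. -/
def prefactor (τ : ℝ) : ℂ :=
  -2 * Real.pi * (Real.sqrt 2 : ℂ) * ((τ ^ (-(3 / 2) : ℝ) : ℝ) : ℂ)
    * Complex.exp
        (Complex.I * ((-2 * Real.pi * Real.log τ - Real.pi) / (τ : ℂ) ^ 2 + Real.pi / 4))
    * E τ / A 2 τ ^ (1 / 2 : ℂ)

end SaddleJ

end

noncomputable section

namespace SaddleJ

/-! Everything becomes regular after the scaling `z = i Q / w`, `w = τ²`. With `κ = i/(4π)` the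
saddle equation reads `Q² (Q - 1 + (1 + κ) w) + w² (Q + w) / 4 = 0`, so `p = 1 / Q` satisfies `p = D
(w p)` for a fixed cubic `D` with `D 0 = 1`. Then `m = w p` inverts `m ↦ m / D m`, and `p` is
analytic in `w` (`exists_analytic_recipSaddle`). The expansions of `A₂` and `E` follow from this one
equation, by exact algebra with continuous remainders and Taylor bounds for `log` and `exp`.

For the integral, write `z = q₁ + ε x / w` with `|x| ≤ 1/2`. The phase is a logarithm plus a simple
fraction, so its Taylor series at `q₁` is explicit and its coefficients are multiples of the `A_n`
(`NearSaddle.hasSum_phase`). The saddle equation is `A₁ = 1`, which cancels the linear term. For `x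
= τ y` the quadratic term is `-π A₂ y² / 2`, because `ε² = i`. On the whole segment the higher terms
have modulus at most `0.43 π y²`, whereas the Gaussian decays at least like `exp (-0.475 π y²)`.
Hence a fixed Gaussian dominates the integrand uniformly in `τ`.

For fixed `y`, the integrand divided by the Gaussian is `a(u) exp (h(u))` at `u = τ`, for two power
series with bounded weighted `ℓ¹`-norm at radius `r = 1 / (2 (1 + |y|))`. If `τ ≤ r`, the Taylor
remainder of order `N` is bounded by `(τ / r)^N` times a majorant (`norm_mul_exp_sub_le`). If `τ >
r`, this factor exceeds `1` and the integrand and its approximation are bounded separately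
(`norm_sum_mulExpCoeff_le`). Since `(τ / r)^N = (2 τ (1 + |y|))^N`, integration in `y` gives an
error `O(τ^N)` relative to the prefactor (`NearSaddle.norm_localIntegrand_sub_le`). The Taylor
coefficients are polynomials in `y`, whose Gaussian integrals are the `F_m`. -/

/-- The constant `i / (4 π)`. -/
def kap : ℂ := Complex.I / (4 * Real.pi)

lemma one_div_four_pi : (1 : ℂ) / (4 * Real.pi) = -Complex.I * kap := by
  have h : (Real.pi : ℂ) ≠ 0 := by exact_mod_cast Real.pi_ne_zero
  unfold kap
  field_simp
  simp

lemma div_four_pi_I (w : ℂ) : w / (4 * Real.pi * Complex.I) = -(kap * w) := by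
  have h : (Real.pi : ℂ) ≠ 0 := by exact_mod_cast Real.pi_ne_zero
  unfold kap
  field_simp
  simp

/-! ### The main saddle as an analytic function of `τ²` -/

/-- The reciprocal `p = 1 / Q₁` of the scaled saddle is an analytic function of `w = τ²`. -/
theorem exists_analytic_recipSaddle :
    ∃ p : ℂ → ℂ, AnalyticAt ℂ p 0 ∧ p 0 = 1 ∧ ∀ᶠ w in 𝓝 (0 : ℂ),
      p w = 1 + (1 + kap) * (w * p w) + (w * p w) ^ 2 / 4 + (w * p w) ^ 3 / 4 := by
  set D : ℂ → ℂ := fun m => 1 + (1 + kap) * m + m ^ 2 / 4 + m ^ 3 / 4 with hD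
  have hD0 : D 0 = 1 := by simp [hD]
  have hDa : AnalyticAt ℂ D 0 := by simp only [hD]; fun_prop
  -- With `m = w p` the equation `p = D (w p)` becomes `m / D m = w`. The left side has derivative
  -- `1` at `0`, so it has an analytic local inverse `g`, and `p = D ∘ g`.
  have hf : AnalyticAt ℂ (fun m => m / D m) 0 :=
    analyticAt_id.div hDa (by rw [hD0]; exact one_ne_zero)
  have hd : HasDerivAt (fun m => m / D m) 1 0 := by
    refine ((hasDerivAt_id' (0 : ℂ)).fun_div hDa.differentiableAt.hasDerivAt
      (by rw [hD0]; exact one_ne_zero)).congr_deriv ?_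
    simp [hD0]
  have hf' : deriv (fun m => m / D m) 0 ≠ 0 := by rw [hd.deriv]; exact one_ne_zero
  have hga := hf.analyticAt_localInverse hf'
  have hgr := (hf.hasStrictDerivAt.hasStrictFDerivAt_equiv hf').eventually_right_inverse
  have hgi := (hf.hasStrictDerivAt.hasStrictFDerivAt_equiv hf').localInverse_apply_image
  change AnalyticAt ℂ ((hf.hasStrictDerivAt.hasStrictFDerivAt_equiv hf').localInverse _ _ _) _
    at hga
  set g := (hf.hasStrictDerivAt.hasStrictFDerivAt_equiv hf').localInverse
  simp only [zero_div] at hga hgi hgr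
  have hDg : AnalyticAt ℂ (fun w => D (g w)) 0 := by
    have : AnalyticAt ℂ D (g 0) := by rw [hgi]; exact hDa
    exact this.comp hga
  refine ⟨fun w => D (g w), hDg, by simp [hgi, hD0], ?_⟩
  have hne : ∀ᶠ w in 𝓝 (0 : ℂ), D (g w) ≠ 0 :=
    hDg.continuousAt.eventually_ne (by simp [hgi, hD0])
  filter_upwards [hgr, hne] with w hw hn
  have : g w = w * D (g w) := by rw [div_eq_iff hn] at hw; exact hw
  simp only [← this]
  rfl

/-- The analytic branch of `1 / Q₁` as a function of `w = τ²`. -/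
def recipSaddle : ℂ → ℂ := Classical.choose exists_analytic_recipSaddle

lemma analyticAt_recipSaddle : AnalyticAt ℂ recipSaddle 0 :=
  (Classical.choose_spec exists_analytic_recipSaddle).1

lemma recipSaddle_zero : recipSaddle 0 = 1 :=
  (Classical.choose_spec exists_analytic_recipSaddle).2.1

lemma recipSaddle_eq : ∀ᶠ w in 𝓝 (0 : ℂ), recipSaddle w = 1 + (1 + kap) * (w * recipSaddle w)
    + (w * recipSaddle w) ^ 2 / 4 + (w * recipSaddle w) ^ 3 / 4 :=
  (Classical.choose_spec exists_analytic_recipSaddle).2.2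

lemma tendsto_recipSaddle : Tendsto recipSaddle (𝓝 0) (𝓝 1) := by
  simpa [ContinuousAt, recipSaddle_zero] using analyticAt_recipSaddle.continuousAt

lemma tendsto_ofReal_sq : Tendsto (fun τ : ℝ => (τ : ℂ) ^ 2) (𝓝[>] 0) (𝓝 0) := by
  have : Continuous fun τ : ℝ => (τ : ℂ) ^ 2 := by fun_prop
  simpa using (this.tendsto 0).mono_left nhdsWithin_le_nhds

/-- The saddle polynomial in the scaled variable `z = i Q / w`. -/
lemma saddlePoly_scaled {τ : ℝ} (hτ : τ ≠ 0) (Q : ℂ) :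
    saddlePoly τ (Complex.I * Q / (τ : ℂ) ^ 2) * (Complex.I * ((τ : ℂ) ^ 2) ^ 3) =
      Q ^ 2 * (Q - 1 + (1 + kap) * (τ : ℂ) ^ 2)
        + ((τ : ℂ) ^ 2) ^ 2 * (Q + (τ : ℂ) ^ 2) / 4 := by
  have hτ' : (τ : ℂ) ≠ 0 := by exact_mod_cast hτ
  have h4 : Complex.I ^ 4 = 1 := by simp
  unfold saddlePoly
  rw [one_div_four_pi]
  field_simp
  ring_nf
  simp only [h4, Complex.I_sq]
  ring_nf

lemma sub_center_scaled {τ : ℝ} (hτ : τ ≠ 0) (Q : ℂ) :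
    Complex.I * Q / (τ : ℂ) ^ 2 - (Complex.I / (τ : ℂ) ^ 2 + 1 / (4 * Real.pi) - Complex.I) =
      Complex.I / (τ : ℂ) ^ 2 * (Q - 1 + (1 + kap) * (τ : ℂ) ^ 2) := by
  have hτ' : (τ : ℂ) ≠ 0 := by exact_mod_cast hτ
  rw [one_div_four_pi]
  field_simp
  ring_nf

/-- The scaling multiplies distances by `τ²`, which turns the radius `τ² / 2` into `τ⁴ / 2`. -/
lemma isMainSaddle_scaled_iff {τ : ℝ} (hτ : 0 < τ) (Q : ℂ) :
    IsMainSaddle τ (Complex.I * Q / (τ : ℂ) ^ 2) ↔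
      Q ^ 2 * (Q - 1 + (1 + kap) * (τ : ℂ) ^ 2)
        + ((τ : ℂ) ^ 2) ^ 2 * (Q + (τ : ℂ) ^ 2) / 4 = 0 ∧
      ‖Q - 1 + (1 + kap) * (τ : ℂ) ^ 2‖ ≤ τ ^ 4 / 2 := by
  have hτ' : (τ : ℂ) ≠ 0 := by exact_mod_cast hτ.ne'
  unfold IsMainSaddle
  rw [← saddlePoly_scaled hτ.ne', sub_center_scaled hτ.ne']
  refine and_congr ?_ ?_
  · simp [hτ']
  · rw [norm_mul, norm_div, Complex.norm_I, norm_pow, Complex.norm_real, Real.norm_eq_abs,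
      abs_of_pos hτ, one_div, inv_mul_le_iff₀ (by positivity)]
    ring_nf

/-- The cubic has derivative close to `1` near `Q = 1`: the difference of the two equations is `Q' -
Q` times `1` plus a term of modulus below `1`. -/
lemma saddle_unique_aux {w Q Q' : ℂ} (hQ : ‖Q - 1‖ ≤ 1 / 20) (hQ' : ‖Q' - 1‖ ≤ 1 / 20)
    (hw : ‖(1 + kap) * w‖ ≤ 1 / 20) (hw1 : ‖w‖ ≤ 1)
    (h : Q ^ 2 * (Q - 1 + (1 + kap) * w) + w ^ 2 * (Q + w) / 4 = 0)
    (h' : Q' ^ 2 * (Q' - 1 + (1 + kap) * w) + w ^ 2 * (Q' + w) / 4 = 0) : Q' = Q := by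
  set a := Q - 1
  set b := Q' - 1
  set v := (1 + kap) * w
  have hQa : Q = 1 + a := by ring
  have hQb : Q' = 1 + b := by ring
  have hfac : (b - a) * (1 + (2 * a + 2 * b + a * a + a * b + b * b + v * 2 + v * a + v * b
      + w ^ 2 / 4)) = 0 := by
    have := congrArg₂ (· - ·) h' h
    simp only [hQa, hQb, sub_zero] at this
    linear_combination this
  rcases mul_eq_zero.1 hfac with h0 | h0
  · rw [hQa, hQb, sub_eq_zero.1 h0]
  · exfalso
    have h1 : ‖(2 * a + 2 * b + a * a + a * b + b * b + v * 2 + v * a + v * b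
      + w ^ 2 / 4)‖ = 1 := by
      rw [← norm_neg, ← sub_eq_zero.1 ((sub_neg_eq_add _ _).trans h0), norm_one]
    have h2 : ‖(2 * a + 2 * b + a * a + a * b + b * b + v * 2 + v * a + v * b
      + w ^ 2 / 4)‖ ≤ 2 * ‖a‖ + 2 * ‖b‖ + ‖a‖ * ‖a‖ + ‖a‖ * ‖b‖ + ‖b‖ * ‖b‖ + ‖v‖ * 2
        + ‖v‖ * ‖a‖ + ‖v‖ * ‖b‖ + ‖w‖ ^ 2 / 4 := by
      refine (norm_add_le_of_le (norm_add_le_of_le (norm_add_le_of_le (norm_add_le_of_le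
        (norm_add_le_of_le (norm_add_le_of_le (norm_add_le_of_le (norm_add_le_of_le le_rfl le_rfl)
        le_rfl) le_rfl) le_rfl) le_rfl) le_rfl) le_rfl) le_rfl).trans_eq ?_
      simp
    nlinarith [norm_nonneg a, norm_nonneg b, norm_nonneg v, norm_nonneg w,
      mul_le_mul hQ hQ (norm_nonneg _) (by norm_num), mul_le_mul hQ hQ' (norm_nonneg _) (by norm_num),
      mul_le_mul hQ' hQ' (norm_nonneg _) (by norm_num),
      mul_le_mul hw hQ (norm_nonneg _) (by norm_num),
      mul_le_mul hw hQ' (norm_nonneg _) (by norm_num)]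

lemma isMainSaddle_recipSaddle : ∀ᶠ τ : ℝ in 𝓝[>] 0,
    IsMainSaddle τ (Complex.I * (1 / recipSaddle ((τ : ℂ) ^ 2)) / (τ : ℂ) ^ 2) ∧
    ∀ z, IsMainSaddle τ z → z = Complex.I * (1 / recipSaddle ((τ : ℂ) ^ 2)) / (τ : ℂ) ^ 2 := by
  have hpt := tendsto_recipSaddle.comp tendsto_ofReal_sq
  have hQt : Tendsto (fun τ : ℝ => 1 / recipSaddle ((τ : ℂ) ^ 2)) (𝓝[>] 0) (𝓝 1) := by
    simpa using hpt.inv₀ one_ne_zero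
  have hR : Tendsto (fun τ : ℝ => ‖(1 / recipSaddle ((τ : ℂ) ^ 2) + (τ : ℂ) ^ 2) *
      recipSaddle ((τ : ℂ) ^ 2) ^ 2‖) (𝓝[>] 0) (𝓝 1) := by
    simpa using ((hQt.add tendsto_ofReal_sq).mul (hpt.pow 2)).norm
  have hv : Tendsto (fun τ : ℝ => ‖(1 + kap) * (τ : ℂ) ^ 2‖) (𝓝[>] 0) (𝓝 0) := by
    simpa using (tendsto_ofReal_sq.const_mul (1 + kap)).norm
  have hQn : Tendsto (fun τ : ℝ => ‖1 / recipSaddle ((τ : ℂ) ^ 2) - 1‖) (𝓝[>] 0) (𝓝 0) := by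
    simpa using (hQt.sub_const 1).norm
  filter_upwards [tendsto_ofReal_sq.eventually recipSaddle_eq, self_mem_nhdsWithin,
    hpt.eventually_ne one_ne_zero, hR.eventually_le_const (show (1 : ℝ) < 2 by norm_num),
    hv.eventually_le_const (show (0 : ℝ) < 1 / 40 by norm_num),
    hQn.eventually_le_const (show (0 : ℝ) < 1 / 20 by norm_num),
    Ioo_mem_nhdsGT (show (0 : ℝ) < 1 / 4 by norm_num)] with τ hp hτ hp0 hR hv hQn hτ1
  simp only [Function.comp, Set.mem_Ioi] at hp0 hτ
  have hw1 : ‖(τ : ℂ) ^ 2‖ ≤ 1 := by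
    simp only [norm_pow, Complex.norm_real, Real.norm_eq_abs, abs_of_pos hτ]
    nlinarith [hτ1.2]
  have hτ4 : ‖((τ : ℂ) ^ 2) ^ 2‖ = τ ^ 4 := by
    rw [← pow_mul, norm_pow, Complex.norm_real, Real.norm_eq_abs, abs_of_pos hτ]
  set w : ℂ := (τ : ℂ) ^ 2
  set p := recipSaddle w
  -- The offset from the centre of the disc is about `τ⁴ / 4`; the bound `2` on `(Q + w) p²` keeps
  -- it within `τ⁴ / 2`.
  have hQeq : 1 / p - 1 + (1 + kap) * w = -(w ^ 2 * ((1 / p + w) * p ^ 2) / 4) := by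
    field_simp
    linear_combination -4 * hp
  have hmain : IsMainSaddle τ (Complex.I * (1 / p) / w) := by
    rw [isMainSaddle_scaled_iff hτ]
    refine ⟨?_, ?_⟩
    · change (1 / p) ^ 2 * (1 / p - 1 + (1 + kap) * w) + w ^ 2 * (1 / p + w) / 4 = 0
      rw [hQeq]
      field_simp
      ring
    · change ‖1 / p - 1 + (1 + kap) * w‖ ≤ _
      rw [hQeq, norm_neg, norm_div, norm_mul, hτ4, Complex.norm_ofNat]
      have : 0 < τ ^ 4 := by positivity
      nlinarith
  refine ⟨hmain, fun z hz => ?_⟩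
  have hw0 : w ≠ 0 := by simp [w, hτ.ne']
  have hzz : z = Complex.I * (-Complex.I * w * z) / w := by
    field_simp
    simp
  rw [hzz] at hz ⊢
  have h1 := (isMainSaddle_scaled_iff hτ _).1 hz
  have h2 := (isMainSaddle_scaled_iff hτ _).1 hmain
  congr 2
  refine saddle_unique_aux hQn ?_ (hv.trans (by norm_num)) hw1 h2.1 h1.1
  -- A competing root is within `τ⁴ / 2 ≤ 1/512` of the centre, which is within `1/40` of `1`; the
  -- sum stays below the `1/20` needed for uniqueness.
  have := norm_sub_le (-Complex.I * w * z - 1 + (1 + kap) * w) ((1 + kap) * w)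
  rw [add_sub_cancel_right] at this
  have h3 := h1.2
  have : τ ^ 4 ≤ (1 / 4) ^ 4 := by
    have := hτ1.2.le
    gcongr
  change ‖-Complex.I * w * z - 1 + (1 + kap) * w‖ ≤ _ at h3
  linarith

lemma q₁_eq : ∀ᶠ τ : ℝ in 𝓝[>] 0,
    q₁ τ = Complex.I * (1 / recipSaddle ((τ : ℂ) ^ 2)) / (τ : ℂ) ^ 2 := by
  filter_upwards [isMainSaddle_recipSaddle] with τ h
  exact h.2 _ (Classical.epsilon_spec ⟨_, h.1⟩)

lemma Q₁_eq : ∀ᶠ τ : ℝ in 𝓝[>] 0, Q₁ τ = 1 / recipSaddle ((τ : ℂ) ^ 2) := by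
  filter_upwards [q₁_eq, self_mem_nhdsWithin] with τ h hτ
  have : (τ : ℂ) ≠ 0 := by exact_mod_cast (Set.mem_Ioi.1 hτ).ne'
  rw [Q₁, h]
  field_simp
  simp [neg_div]

lemma isMainSaddle_q₁ : ∀ᶠ τ : ℝ in 𝓝[>] 0,
    IsMainSaddle τ (q₁ τ) ∧ ∀ z, IsMainSaddle τ z → z = q₁ τ := by
  filter_upwards [isMainSaddle_recipSaddle, q₁_eq] with τ h h'
  rw [h']
  exact h

/-! ### Derivatives of the phase at the saddle -/

/-- The coefficient of the logarithm in the phase. -/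
def logWeight (τ : ℝ) : ℂ := (1 / 2 + 2 * Real.pi * Complex.I / (τ : ℂ) ^ 2) / 2

/-- The domain on which the derivatives of the phase are computed. -/
def phaseDomain : Set ℂ := {z | z ≠ 0 ∧ 1 - Complex.I * z ∈ Complex.slitPlane}

lemma isOpen_phaseDomain : IsOpen phaseDomain :=
  isOpen_ne.inter (Complex.isOpen_slitPlane.preimage (by fun_prop))

lemma add_I_ne_zero {z : ℂ} (hz : z ∈ phaseDomain) : z + Complex.I ≠ 0 := by
  intro h
  have : 1 - Complex.I * z = -Complex.I * (z + Complex.I) := by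
    ring_nf; simp; ring
  exact Complex.slitPlane_ne_zero hz.2 (by rw [this, h, mul_zero])

lemma hasDerivAt_phase (τ : ℝ) {z : ℂ} (hz : z ∈ phaseDomain) :
    HasDerivAt (phase τ)
      (-Real.pi + Real.pi / (4 * z ^ 2) + logWeight τ / (z + Complex.I)) z := by
  have h0 := hz.1
  have hI := add_I_ne_zero hz
  have hs := Complex.slitPlane_ne_zero hz.2
  have h1 : HasDerivAt (fun z : ℂ => -(Real.pi : ℂ) * z) (-Real.pi) z := by
    simpa using (hasDerivAt_id z).const_mul (-(Real.pi : ℂ))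
  have h2 : HasDerivAt (fun z : ℂ => (Real.pi : ℂ) / (4 * z)) (-(Real.pi / (4 * z ^ 2))) z := by
    refine ((hasDerivAt_const z (Real.pi : ℂ)).fun_div ((hasDerivAt_id' z).const_mul 4)
      (by simpa using h0)).congr_deriv ?_
    field_simp
    ring
  have h3 : HasDerivAt (fun z : ℂ => 1 - Complex.I * z) (-Complex.I) z := by
    simpa using ((hasDerivAt_id z).const_mul Complex.I).const_sub 1
  have h4 := (h3.clog hz.2).const_mul (logWeight τ)
  refine ((h1.sub h2).add h4).congr_deriv ?_
  have : -Complex.I / (1 - Complex.I * z) = 1 / (z + Complex.I) := by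
    rw [div_eq_div_iff hs hI]
    ring_nf
    simp
    ring
  rw [this]
  ring

lemma iteratedDeriv_phase (τ : ℝ) (n : ℕ) : ∀ z ∈ phaseDomain,
    iteratedDeriv (n + 2) (phase τ) z = (-1) ^ (n + 1) * ((n + 1).factorial : ℂ) *
      ((n + 2) * Real.pi / 4 / z ^ (n + 3) + logWeight τ / (z + Complex.I) ^ (n + 2)) := by
  have hpow : ∀ (m : ℕ) (a : ℂ) {z : ℂ}, z + a ≠ 0 →
      HasDerivAt (fun z : ℂ => 1 / (z + a) ^ m) (-(m : ℂ) / (z + a) ^ (m + 1)) z := by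
    intro m a z hz
    have h := (((hasDerivAt_id' z).add_const a).fun_pow m).fun_inv (pow_ne_zero m hz)
    simp only [one_div]
    refine h.congr_deriv ?_
    rcases m with _ | m
    · simp
    · simp only [Nat.add_sub_cancel]
      field_simp
      ring
  induction n with
  | zero =>
    intro z hz
    rw [show (0 + 2 : ℕ) = 1 + 1 from rfl, iteratedDeriv_succ, iteratedDeriv_one]
    have he : deriv (phase τ) =ᶠ[𝓝 z] fun z =>
        -Real.pi + Real.pi / 4 * (1 / (z + 0) ^ 2)
          + logWeight τ * (1 / (z + Complex.I) ^ 1) := by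
      filter_upwards [isOpen_phaseDomain.mem_nhds hz] with y hy
      rw [(hasDerivAt_phase τ hy).deriv, add_zero]
      ring
    rw [he.deriv_eq]
    have h1 := ((hpow 2 0 (z := z) (by simpa using hz.1)).const_mul ((Real.pi : ℂ) / 4)).const_add
      (-(Real.pi : ℂ))
    have h2 := (hpow 1 Complex.I (add_I_ne_zero hz)).const_mul (logWeight τ)
    rw [(h1.fun_add h2).deriv]
    simp
    ring
  | succ n ih =>
    intro z hz
    rw [show n + 1 + 2 = (n + 2) + 1 from rfl, iteratedDeriv_succ]
    have he : iteratedDeriv (n + 2) (phase τ) =ᶠ[𝓝 z] fun z =>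
        (-1) ^ (n + 1) * ((n + 1).factorial : ℂ) *
      ((n + 2) * Real.pi / 4 * (1 / (z + 0) ^ (n + 3))
        + logWeight τ * (1 / (z + Complex.I) ^ (n + 2))) := by
      filter_upwards [isOpen_phaseDomain.mem_nhds hz] with y hy
      rw [ih y hy, add_zero]
      ring
    rw [he.deriv_eq]
    have h1 := (hpow (n + 3) 0 (z := z) (by simpa using hz.1)).const_mul
      (((n : ℂ) + 2) * Real.pi / 4)
    have h2 := (hpow (n + 2) Complex.I (add_I_ne_zero hz)).const_mul (logWeight τ)
    rw [((h1.fun_add h2).const_mul _).deriv]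
    rw [Nat.factorial_succ (n + 1)]
    push_cast
    ring

lemma eventually_Q₁_near_one {ε : ℝ} (hε : 0 < ε) :
    ∀ᶠ τ : ℝ in 𝓝[>] 0, ‖Q₁ τ - 1‖ < ε ∧ ‖Q₁ τ + (τ : ℂ) ^ 2 - 1‖ < ε ∧
      ‖(Q₁ τ)⁻¹‖ < 1 + ε ∧ ‖(Q₁ τ + (τ : ℂ) ^ 2)⁻¹‖ < 1 + ε := by
  have hQ : Tendsto (fun τ : ℝ => Q₁ τ) (𝓝[>] 0) (𝓝 1) := by
    have h : Tendsto (fun τ : ℝ => 1 / recipSaddle ((τ : ℂ) ^ 2)) (𝓝[>] 0) (𝓝 1) := by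
      simpa using (tendsto_recipSaddle.comp tendsto_ofReal_sq).inv₀ one_ne_zero
    refine h.congr' ?_
    filter_upwards [Q₁_eq] with τ h using h.symm
  have hT : Tendsto (fun τ : ℝ => Q₁ τ + (τ : ℂ) ^ 2) (𝓝[>] 0) (𝓝 1) := by
    simpa using hQ.add tendsto_ofReal_sq
  have a1 : Tendsto (fun τ : ℝ => ‖Q₁ τ - 1‖) (𝓝[>] 0) (𝓝 0) := by
    simpa using (hQ.sub_const 1).norm
  have a2 : Tendsto (fun τ : ℝ => ‖Q₁ τ + (τ : ℂ) ^ 2 - 1‖) (𝓝[>] 0) (𝓝 0) := by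
    simpa using (hT.sub_const 1).norm
  have a3 : Tendsto (fun τ : ℝ => ‖(Q₁ τ)⁻¹‖) (𝓝[>] 0) (𝓝 1) := by
    simpa using (hQ.inv₀ one_ne_zero).norm
  have a4 : Tendsto (fun τ : ℝ => ‖(Q₁ τ + (τ : ℂ) ^ 2)⁻¹‖) (𝓝[>] 0) (𝓝 1) := by
    simpa using (hT.inv₀ one_ne_zero).norm
  filter_upwards [a1.eventually_lt_const hε, a2.eventually_lt_const hε,
    a3.eventually_lt_const (show (1 : ℝ) < 1 + ε by linarith),
    a4.eventually_lt_const (show (1 : ℝ) < 1 + ε by linarith)] with τ h1 h2 h3 h4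
  exact ⟨h1, h2, h3, h4⟩

lemma re_pos_of_near_one {z : ℂ} (h : ‖z - 1‖ < 1) : 0 < z.re := by
  have h1 := (abs_le.1 (Complex.abs_re_le_norm (z - 1))).1
  simp only [Complex.sub_re, Complex.one_re] at h1
  linarith

lemma q₁_eq_Q₁ {τ : ℝ} (hτ : τ ≠ 0) : q₁ τ = Complex.I * Q₁ τ / (τ : ℂ) ^ 2 := by
  have : (τ : ℂ) ≠ 0 := by exact_mod_cast hτ
  rw [Q₁]
  field_simp
  simp

/-- `1 - i q₁ = (Q₁ + τ²) / τ²` has positive real part, since `Q₁ + τ²` is close to `1`. -/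
lemma q₁_mem_phaseDomain : ∀ᶠ τ : ℝ in 𝓝[>] 0, q₁ τ ∈ phaseDomain := by
  filter_upwards [eventually_Q₁_near_one one_pos, self_mem_nhdsWithin] with τ h hτ
  have hτ0 : 0 < τ := hτ
  have hτ' : (τ : ℂ) ≠ 0 := by exact_mod_cast hτ0.ne'
  have h1 := re_pos_of_near_one h.1
  have h2 := re_pos_of_near_one h.2.1
  have hQ0 : Q₁ τ ≠ 0 := fun h0 => by simp [h0] at h1
  refine ⟨?_, Or.inl ?_⟩
  · rw [q₁_eq_Q₁ hτ0.ne']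
    exact div_ne_zero (mul_ne_zero Complex.I_ne_zero hQ0) (pow_ne_zero 2 hτ')
  · have : 1 - Complex.I * q₁ τ = (Q₁ τ + (τ : ℂ) ^ 2) / ((τ ^ 2 : ℝ) : ℂ) := by
      rw [q₁_eq_Q₁ hτ0.ne']
      push_cast
      field_simp
      simp
      ring
    rw [this, Complex.div_ofReal_re]
    positivity

lemma deriv_phase_q₁ : ∀ᶠ τ : ℝ in 𝓝[>] 0, deriv (phase τ) (q₁ τ) = 0 := by
  filter_upwards [q₁_mem_phaseDomain, isMainSaddle_q₁, self_mem_nhdsWithin] with τ hq hs hτ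
  have hτ' : (τ : ℂ) ≠ 0 := by exact_mod_cast (Set.mem_Ioi.1 hτ).ne'
  have h0 := hq.1
  have hI := add_I_ne_zero hq
  have hpi : (Real.pi : ℂ) ≠ 0 := by exact_mod_cast Real.pi_ne_zero
  rw [(hasDerivAt_phase τ hq).deriv]
  have hP := hs.1.1
  unfold saddlePoly at hP
  unfold logWeight
  set q := q₁ τ
  field_simp at hP ⊢
  linear_combination (-4 * hP)

lemma A_eq_iteratedDeriv : ∀ᶠ τ : ℝ in 𝓝[>] 0, ∀ n : ℕ, 2 ≤ n →
    A n τ = iteratedDeriv n (phase τ) (q₁ τ) /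
      (Real.pi * (Complex.I * (τ : ℂ) ^ 2) ^ (n - 1) * ((n - 1).factorial : ℂ)) := by
  filter_upwards [q₁_mem_phaseDomain, self_mem_nhdsWithin,
    eventually_Q₁_near_one one_pos] with τ hq hτ hQ n hn
  obtain ⟨n, rfl⟩ := Nat.exists_eq_add_of_le' hn
  have hτ0 : 0 < τ := hτ
  have hτ' : (τ : ℂ) ≠ 0 := by exact_mod_cast hτ0.ne'
  have hpi : (Real.pi : ℂ) ≠ 0 := by exact_mod_cast Real.pi_ne_zero
  have h1 := re_pos_of_near_one hQ.1
  have h2 := re_pos_of_near_one hQ.2.1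
  have hQ0 : Q₁ τ ≠ 0 := fun h0 => by simp [h0] at h1
  have hT0 : Q₁ τ + (τ : ℂ) ^ 2 ≠ 0 := fun h0 => by simp [h0] at h2
  have hf : ((n + 1).factorial : ℂ) ≠ 0 := by exact_mod_cast (n + 1).factorial_ne_zero
  rw [iteratedDeriv_phase τ n _ hq, eq_div_iff (by simp [hpi, hτ', hf])]
  have hqI : q₁ τ + Complex.I = Complex.I * (Q₁ τ + (τ : ℂ) ^ 2) / (τ : ℂ) ^ 2 := by
    rw [q₁_eq_Q₁ hτ0.ne']
    field_simp
  have hII : Complex.I ^ n * Complex.I ^ n = (-1) ^ n := by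
    rw [← mul_pow, Complex.I_mul_I]
  have hI0 : Complex.I ^ n ≠ 0 := pow_ne_zero _ Complex.I_ne_zero
  have h11 : ((-1 : ℂ) ^ n) * (-1) ^ n = 1 := by rw [← mul_pow]; simp
  rw [hqI, q₁_eq_Q₁ hτ0.ne', A, logWeight]
  set w := (τ : ℂ) ^ 2
  have hw : (τ : ℂ) ^ 4 = w ^ 2 := by simp only [w]; ring
  rw [hw]
  have hw0 : w ≠ 0 := pow_ne_zero 2 hτ'
  set Q := Q₁ τ
  -- Extracting `π i / w` from the weight of the logarithm leaves exactly the factor `1 + τ² / (4 π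
  -- i)` in the definition of `A`.
  have e1 : ((1 : ℂ) / 2 + 2 * Real.pi * Complex.I / w) / 2
      = Real.pi * Complex.I / w * (1 + w / (4 * Real.pi * Complex.I)) := by
    field_simp
    ring
  rw [e1]
  set L := 1 + w / (4 * Real.pi * Complex.I)
  have e2 : ∀ X : ℂ, (Complex.I * X / w) ^ (n + 3) =
      Complex.I ^ n * (-Complex.I) * X ^ (n + 3) / (w ^ n * w ^ 3) := by
    intro X
    rw [div_pow, mul_pow, pow_add, pow_add w]
    simp [pow_succ]
  have e3 : ∀ X : ℂ, (Complex.I * X / w) ^ (n + 2) =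
      -Complex.I ^ n * X ^ (n + 2) / (w ^ n * w ^ 2) := by
    intro X
    rw [div_pow, mul_pow, pow_add, pow_add w]
    simp
  rw [e2 Q, e3]
  simp only [show n + 2 - 1 = n + 1 from rfl, mul_pow, pow_succ (-1 : ℂ), pow_succ Complex.I n]
  rw [← hII]
  push_cast
  have hI1 := Complex.I_ne_zero
  field_simp
  rw [Complex.I_sq]
  ring

/-! ### Expansions of `A₂` and `E` in powers of `τ²` -/

lemma isBigO_pow_of_eventually_eq {f R : ℂ → ℂ} {n : ℕ} (hR : ContinuousAt R 0)
    (h : ∀ᶠ w in 𝓝 (0 : ℂ), f w = w ^ n * R w) : f =O[𝓝 0] fun w => w ^ n := by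
  have h1 : (fun w : ℂ => w ^ n * R w) =O[𝓝 0] fun w => w ^ n * (1 : ℂ) :=
    (isBigO_refl _ _).mul (hR.tendsto.isBigO_one ℂ)
  simp only [mul_one] at h1
  exact h1.congr' (h.mono fun _ hw => hw.symm) EventuallyEq.rfl

lemma isBigO_comp_sq {f : ℂ → ℂ} {n k : ℕ} (hk : k ≤ 2 * n)
    (h : f =O[𝓝 0] fun w => w ^ n) {g : ℝ → ℂ}
    (hg : ∀ᶠ τ : ℝ in 𝓝[>] 0, g τ = f ((τ : ℂ) ^ 2)) :
    g =O[𝓝[>] 0] fun τ : ℝ => τ ^ k := by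
  have h1 := h.comp_tendsto tendsto_ofReal_sq
  refine (h1.congr' (hg.mono fun _ h => h.symm) EventuallyEq.rfl).trans ?_
  refine IsBigO.of_bound 1 ?_
  filter_upwards [Ioo_mem_nhdsGT (show (0 : ℝ) < 1 by norm_num)] with τ hτ
  simp only [Function.comp, norm_pow, Complex.norm_real, Real.norm_eq_abs, abs_of_pos hτ.1, one_mul,
    ← pow_mul]
  exact pow_le_pow_of_le_one hτ.1.le hτ.2.le hk

/-- The second order remainder of `recipSaddle`. -/
def recipSaddleRem (w : ℂ) : ℂ :=
  (1 + kap) * ((1 + kap) * recipSaddle w + w * recipSaddle w ^ 2 / 4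
    + w ^ 2 * recipSaddle w ^ 3 / 4) + recipSaddle w ^ 2 / 4 + w * recipSaddle w ^ 3 / 4

lemma continuousAt_recipSaddle : ContinuousAt recipSaddle 0 :=
  analyticAt_recipSaddle.continuousAt

lemma continuousAt_recipSaddleRem : ContinuousAt recipSaddleRem 0 := by
  have := continuousAt_recipSaddle
  unfold recipSaddleRem
  fun_prop

/-- The saddle equation is substituted once into its own linear term. The remainder is an exact
polynomial in `w` and `p`, so continuity alone bounds it. -/
lemma recipSaddle_expansion : ∀ᶠ w in 𝓝 (0 : ℂ),
    recipSaddle w = 1 + (1 + kap) * w + w ^ 2 * recipSaddleRem w := by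
  filter_upwards [recipSaddle_eq] with w h
  unfold recipSaddleRem
  linear_combination h + (1 + kap) * w * h

/-- `Q₁ + τ²` as a function of `w = τ²`, in polynomial form. -/
lemma scaled_add_eq : ∀ᶠ w in 𝓝 (0 : ℂ), 1 / recipSaddle w + w =
    1 + (-kap * w - w ^ 2 * recipSaddle w / 4 - w ^ 3 * recipSaddle w ^ 2 / 4) := by
  filter_upwards [recipSaddle_eq, continuousAt_recipSaddle.eventually_ne
    (by rw [recipSaddle_zero]; exact one_ne_zero)] with w h h0
  rw [div_add' _ _ _ h0, div_eq_iff h0]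
  linear_combination -h

lemma analyticAt_recipSaddle_sq : AnalyticAt ℂ (fun s : ℂ => recipSaddle (s ^ 2)) 0 := by
  have h : AnalyticAt ℂ recipSaddle ((0 : ℂ) ^ 2) := by simpa using analyticAt_recipSaddle
  exact h.comp (f := fun s : ℂ => s ^ 2) (by fun_prop)

lemma A_isPowerSeriesNearZero (n : ℕ) : IsPowerSeriesNearZero (A n) 1 := by
  have hp := analyticAt_recipSaddle_sq
  have hp0 : recipSaddle ((0 : ℂ) ^ 2) ≠ 0 := by simp [recipSaddle_zero]
  have hQ : AnalyticAt ℂ (fun s : ℂ => 1 / recipSaddle (s ^ 2)) 0 :=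
    analyticAt_const.div hp hp0
  refine ⟨fun s => (1 + s ^ 2 / (4 * Real.pi * Complex.I)) / (1 / recipSaddle (s ^ 2) + s ^ 2) ^ n
    - n * s ^ 4 / (4 * (1 / recipSaddle (s ^ 2)) ^ (n + 1)), ?_, ?_, ?_⟩
  · refine AnalyticAt.sub (AnalyticAt.div ?_ ((hQ.add (by fun_prop)).pow n) ?_)
      (AnalyticAt.div (by fun_prop) (analyticAt_const.mul (hQ.pow _)) ?_)
    · exact analyticAt_const.add (AnalyticAt.div_const (by fun_prop))
    · simp [recipSaddle_zero]
    · simp [recipSaddle_zero]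
  · simp [recipSaddle_zero]
  · filter_upwards [Q₁_eq] with τ h
    rw [A, h]

lemma B_isPowerSeriesNearZero (n : ℕ) : IsPowerSeriesNearZero (B n) 1 := by
  have hp := analyticAt_recipSaddle_sq
  have hp0 : recipSaddle ((0 : ℂ) ^ 2) ≠ 0 := by simp [recipSaddle_zero]
  have hQ : AnalyticAt ℂ (fun s : ℂ => 1 / recipSaddle (s ^ 2)) 0 :=
    analyticAt_const.div hp hp0
  refine ⟨fun s => (1 / recipSaddle (s ^ 2)) ^ (-(5 / 2) - (n : ℂ) : ℂ), ?_, ?_, ?_⟩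
  · refine hQ.cpow analyticAt_const ?_
    simp [recipSaddle_zero]
  · simp [recipSaddle_zero]
  · filter_upwards [Q₁_eq] with τ h
    rw [B, h]

/-- With `m = w p`, the saddle equation factors as `(1 - κ w) p = (1 + m) (1 + m² / 4)`. Hence `(1 -
κ w) A₂ = 1 - m³/2 - m⁴/16 - m⁵/8`: the powers of `κ` come from the geometric series of `1 / (1 - κ
w)`, and other contributions start at `w³`. -/
lemma A_two_expansion :
    (fun τ : ℝ => A 2 τ -
        (1 + Complex.I / (4 * Real.pi) * (τ : ℂ) ^ 2 - 1 / (16 * Real.pi ^ 2) * (τ : ℂ) ^ 4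
          + (-(1 / 2) - Complex.I / (64 * Real.pi ^ 3)) * (τ : ℂ) ^ 6
          + 1 / 256 * (-400 + 1 / Real.pi ^ 4 - 128 * Complex.I / Real.pi) * (τ : ℂ) ^ 8))
      =O[𝓝[>] 0] fun τ : ℝ => τ ^ 10 := by
  set f : ℂ → ℂ := fun w =>
    ((1 - kap * w) / (1 / recipSaddle w + w) ^ 2 - 2 * w ^ 2 / (4 * (1 / recipSaddle w) ^ 3)) -
      (1 + kap * w + kap ^ 2 * w ^ 2 + (-(1 / 2) + kap ^ 3) * w ^ 3
        + (kap ^ 4 - 2 * kap - 25 / 16) * w ^ 4) with hf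
  have hk2 : kap ^ 2 = -(1 / (16 * Real.pi ^ 2)) := by
    rw [kap, div_pow, Complex.I_sq]; ring
  have hk3 : kap ^ 3 = -(Complex.I / (64 * Real.pi ^ 3)) := by
    rw [pow_succ, hk2, kap]; ring
  have hk4 : kap ^ 4 = 1 / (256 * Real.pi ^ 4) := by
    rw [show kap ^ 4 = (kap ^ 2) ^ 2 by ring, hk2]; ring
  refine isBigO_comp_sq (f := f) (n := 5) (by norm_num) ?_ ?_
  · have hc := continuousAt_recipSaddle
    have hcr := continuousAt_recipSaddleRem
    have hkw : ContinuousAt (fun w : ℂ => 1 - kap * w) 0 := by fun_prop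
    have hmt : ContinuousAt (fun w : ℂ => 1 + w * recipSaddle w) 0 := by fun_prop
    -- `R` is the explicit quotient by `w⁵`, obtained by inserting `p = 1 + w (1 + κ + w x)`, with
    -- `x` the second order remainder, and clearing the denominator `1 - κ w`.
    refine isBigO_pow_of_eventually_eq (R := fun w =>
      (-((3 * recipSaddleRem w + 3 * (1 + kap + w * recipSaddleRem w) ^ 2
          + w * (1 + kap + w * recipSaddleRem w) ^ 3) / 2
        + (1 + kap + w * recipSaddleRem w) * (2 + w * (1 + kap + w * recipSaddleRem w))
          * (1 + recipSaddle w ^ 2) / 16 + recipSaddle w ^ 5 / 8)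
        + kap * (kap ^ 4 - 2 * kap - 25 / 16)) / (1 - kap * w)) ?_ ?_
    · refine ContinuousAt.div (by fun_prop) hkw (by simp)
    · filter_upwards [recipSaddle_eq, recipSaddle_expansion, hc.eventually_ne
        (by rw [recipSaddle_zero]; exact one_ne_zero), hkw.eventually_ne (show 1 - kap * 0 ≠ 0 by simp),
        hmt.eventually_ne (show 1 + 0 * recipSaddle 0 ≠ 0 by simp)] with w h hx hp0 hk0 hm0
      rw [mul_div_assoc', eq_div_iff hk0]
      simp only [hf]
      set p := recipSaddle w
      set x := recipSaddleRem w
      have h1 : 1 / p + w = (1 + w * p) / p := by field_simp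
      have h2 : (1 - kap * w) * p = (1 + w * p) * (1 + (w * p) ^ 2 / 4) := by
        linear_combination h
      have h3 : ((1 - kap * w) / (1 / p + w) ^ 2 - 2 * w ^ 2 / (4 * (1 / p) ^ 3)) * (1 - kap * w)
          = 1 - (w * p) ^ 3 / 2 - (w * p) ^ 4 / 16 - (w * p) ^ 5 / 8 := by
        have e1 : (1 - kap * w) / (1 / p + w) ^ 2 * (1 - kap * w) =
            ((1 - kap * w) * p) ^ 2 / (1 + w * p) ^ 2 := by
          rw [h1]; field_simp
        have e2 : 2 * w ^ 2 / (4 * (1 / p) ^ 3) * (1 - kap * w) =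
            (w * p) ^ 2 / 2 * ((1 - kap * w) * p) := by
          field_simp; ring
        rw [sub_mul, e1, e2, h2, mul_pow, mul_div_cancel_left₀ _ (pow_ne_zero 2 hm0)]
        ring
      rw [sub_mul, h3]
      clear_value p x
      subst hx
      ring
  · filter_upwards [Q₁_eq] with τ h
    rw [A, h, div_four_pi_I]
    simp only [hf, hk2, hk3, hk4]
    rw [kap]
    push_cast
    ring

/-- `τ²/(π i)` times the exponent of `-E`, as a function of `w = τ²`. -/
def scaledExponent (w : ℂ) : ℂ :=
  (1 + kap) * w + w ^ 2 * recipSaddle w / 2 + w ^ 3 * recipSaddle w ^ 2 / 4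
    + (1 - kap * w) * Complex.log (1 / recipSaddle w + w)

lemma scaledExponent_zero : scaledExponent 0 = 0 := by
  simp [scaledExponent, recipSaddle_zero]

lemma analyticAt_scaledExponent : AnalyticAt ℂ scaledExponent 0 := by
  have hp := analyticAt_recipSaddle
  have hQ : AnalyticAt ℂ (fun w : ℂ => 1 / recipSaddle w + w) 0 :=
    (analyticAt_const.div hp (by simp [recipSaddle_zero])).add analyticAt_id
  have hl := hQ.clog (by simp [recipSaddle_zero])
  unfold scaledExponent
  fun_prop

lemma scaledExponent_expansion :
    (fun w => scaledExponent w - (w + (1 / 4 + kap ^ 2 / 2) * w ^ 2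
      + (1 / 4 + kap / 4 + kap ^ 3 / 6) * w ^ 3)) =O[𝓝 0] fun w : ℂ => w ^ 4 := by
  have hc := continuousAt_recipSaddle
  have hcr := continuousAt_recipSaddleRem
  -- `t = Q + w - 1` by `scaled_add_eq`. As `t = O(w)`, the cubic Taylor polynomial of `log (1 + t)`
  -- has error `O(w⁴)`.
  set t : ℂ → ℂ := fun w =>
    -kap * w - w ^ 2 * recipSaddle w / 4 - w ^ 3 * recipSaddle w ^ 2 / 4 with ht
  have htt : Tendsto t (𝓝 0) (𝓝 0) := by
    have : ContinuousAt t 0 := by simp only [ht]; fun_prop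
    simpa [ContinuousAt, ht] using this
  have htO : t =O[𝓝 0] fun w => w ^ 1 := isBigO_pow_of_eventually_eq
    (R := fun w => -kap - w * recipSaddle w / 4 - w ^ 2 * recipSaddle w ^ 2 / 4) (by fun_prop)
    (Eventually.of_forall fun w => by simp only [ht]; ring)
  have hlog : (fun w => (1 - kap * w) *
      (Complex.log (1 + t w) - (t w - t w ^ 2 / 2 + t w ^ 3 / 3))) =O[𝓝 0] fun w => w ^ 4 := by
    have h1 := (Complex.log_sub_logTaylor_isBigO 3).comp_tendsto htt
    have h2 : (fun w => t w ^ 4) =O[𝓝 0] fun w => w ^ 4 := by simpa using htO.pow 4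
    have h3 : (fun w : ℂ => 1 - kap * w) =O[𝓝 0] fun _ => (1 : ℂ) :=
      (ContinuousAt.tendsto (by fun_prop)).isBigO_one ℂ
    refine (h3.mul (h1.trans h2)).congr (fun w => ?_) fun w => by simp
    simp only [Function.comp, Complex.logTaylor, Finset.sum_range_succ, Finset.sum_range_zero]
    push_cast
    ring
  have hpoly : (fun w => (1 + kap) * w + w ^ 2 * recipSaddle w / 2 + w ^ 3 * recipSaddle w ^ 2 / 4
      + (1 - kap * w) * (t w - t w ^ 2 / 2 + t w ^ 3 / 3)
      - (w + (1 / 4 + kap ^ 2 / 2) * w ^ 2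
      + (1 / 4 + kap / 4 + kap ^ 3 / 6) * w ^ 3)) =O[𝓝 0] fun w : ℂ => w ^ 4 := by
    -- Nested exact remainders: `p² = 1 + w y`, `t = -κ w + w² V`, `V = -1/4 + w W`, and `w⁴ G` is
    -- what `t - t²/2 + t³/3` leaves beyond its cubic part in `w`.
    set x := recipSaddleRem with hx
    set y : ℂ → ℂ := fun w => (1 + kap + w * x w) * (2 + (1 + kap) * w + w ^ 2 * x w) with hy
    set W : ℂ → ℂ := fun w => -(2 + kap) / 4 - w * (x w + y w) / 4 with hW
    set V : ℂ → ℂ := fun w => -(1 / 4) + w * W w with hV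
    set G : ℂ → ℂ := fun w => -(x w + y w) / 4 - (-2 * kap * W w + V w ^ 2) / 2
      + V w * (3 * kap ^ 2 - 3 * kap * w * V w + w ^ 2 * V w ^ 2) / 3 with hG
    have hyc : ContinuousAt y 0 := by fun_prop
    have hWc : ContinuousAt W 0 := by fun_prop
    have hVc : ContinuousAt V 0 := by fun_prop
    have hGc : ContinuousAt G 0 := by fun_prop
    refine isBigO_pow_of_eventually_eq (R := fun w => x w / 2 + y w / 4 + G w
      - kap * (-(2 + kap) / 4 - kap / 4 - kap ^ 3 / 3 + w * G w)) (by fun_prop) ?_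
    filter_upwards [recipSaddle_expansion] with w h
    simp only [ht, hG, hV, hW, hy, hx]
    rw [h]
    ring
  refine (hlog.add hpoly).congr' ?_ EventuallyEq.rfl
  filter_upwards [scaled_add_eq] with w h
  rw [scaledExponent, h]
  ring

/-- Since `log (1 - i q₁) = log (Q₁ + w) - 2 log τ`, the `log τ` terms cancel `√τ` and the
oscillating factor of `E`. The rest is `(π i / w) (1 - Q + w² / (4 Q) + (1 - κ w) log (Q + w))`,
where the saddle equation rewrites `1 - Q`. -/
lemma E_eq : ∀ᶠ τ : ℝ in 𝓝[>] 0,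
    E τ = -Complex.exp (Real.pi * Complex.I * (scaledExponent ((τ : ℂ) ^ 2) / (τ : ℂ) ^ 2)) := by
  filter_upwards [Q₁_eq, eventually_Q₁_near_one one_pos, self_mem_nhdsWithin,
    tendsto_ofReal_sq.eventually recipSaddle_eq] with τ h hQ hτ hp
  have hτ0 : 0 < τ := hτ
  have hτ' : (τ : ℂ) ≠ 0 := by exact_mod_cast hτ0.ne'
  have hpi : (Real.pi : ℂ) ≠ 0 := by exact_mod_cast Real.pi_ne_zero
  have h1 := re_pos_of_near_one hQ.1
  have h2 := re_pos_of_near_one hQ.2.1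
  have hQ0 : Q₁ τ ≠ 0 := fun h0 => by simp [h0] at h1
  have hT0 : Q₁ τ + (τ : ℂ) ^ 2 ≠ 0 := fun h0 => by simp [h0] at h2
  have hlog : Complex.log (1 - Complex.I * q₁ τ)
      = Complex.log (Q₁ τ + (τ : ℂ) ^ 2) - 2 * (Real.log τ : ℂ) := by
    have : 1 - Complex.I * q₁ τ = (((τ ^ 2)⁻¹ : ℝ) : ℂ) * (Q₁ τ + (τ : ℂ) ^ 2) := by
      rw [q₁_eq_Q₁ hτ0.ne']
      push_cast
      field_simp
      simp
      ring
    rw [this, Complex.log_ofReal_mul (by positivity) hT0, Real.log_inv, Real.log_pow]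
    push_cast
    ring
  have hsqrt : (Real.sqrt τ : ℂ) = Complex.exp (Real.log τ / 2) := by
    have : Real.sqrt τ = Real.exp (Real.log τ / 2) := by
      rw [Real.exp_half, Real.exp_log hτ0]
    rw [this]
    push_cast
    rfl
  rw [E, hsqrt, neg_mul, neg_mul, ← Complex.exp_add, ← Complex.exp_add]
  congr 2
  rw [phase, hlog, scaledExponent, ← h, q₁_eq_Q₁ hτ0.ne']
  set w := (τ : ℂ) ^ 2
  have hw0 : w ≠ 0 := pow_ne_zero 2 hτ'
  have hpQ : recipSaddle w = 1 / Q₁ τ := by rw [h]; simp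
  rw [hpQ] at hp ⊢
  set Q := Q₁ τ
  have hrel : 1 - Q = (1 + kap) * w + w ^ 2 / Q / 4 + w ^ 3 / Q ^ 2 / 4 := by
    field_simp at hp ⊢
    linear_combination hp
  have hk : kap * w = -(w / (4 * Real.pi * Complex.I)) := by rw [div_four_pi_I]; ring
  have e : (1 + kap) * w + w ^ 2 * (1 / Q) / 2 + w ^ 3 * (1 / Q) ^ 2 / 4
      = 1 - Q + w ^ 2 / Q / 4 := by
    rw [hrel]; ring
  rw [e, hk]
  field_simp
  ring_nf
  simp only [Complex.I_sq]
  ring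

lemma E_analytic_aux : ∃ g : ℂ → ℂ, AnalyticAt ℂ g 0 ∧
    ∀ᶠ τ : ℝ in 𝓝[>] 0, E τ = g (τ : ℂ) := by
  -- The exponent vanishes at `w = 0`, so its quotient by `w` extends analytically.
  obtain ⟨g, hg, hge⟩ := (natCast_le_analyticOrderAt analyticAt_scaledExponent (n := 1)).1 (by
    rw [Nat.cast_one, Order.one_le_iff_pos, pos_iff_ne_zero]
    exact analyticAt_scaledExponent.analyticOrderAt_ne_zero.2 scaledExponent_zero)
  have hg' : AnalyticAt ℂ (fun s : ℂ => g (s ^ 2)) 0 := by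
    have h : AnalyticAt ℂ g ((0 : ℂ) ^ 2) := by simpa using hg
    exact h.comp (f := fun s : ℂ => s ^ 2) (by fun_prop)
  refine ⟨fun s => -Complex.exp (Real.pi * Complex.I * g (s ^ 2)),
    (analyticAt_const.mul hg').cexp.neg, ?_⟩
  filter_upwards [E_eq, tendsto_ofReal_sq.eventually hge, self_mem_nhdsWithin] with τ h h' hτ
  have hτ' : (τ : ℂ) ≠ 0 := by exact_mod_cast (Set.mem_Ioi.1 hτ).ne'
  rw [h, h']
  simp [hτ']

lemma E_expansion : (fun τ : ℝ => E τ -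
        (1 + Complex.I * (8 * Real.pi ^ 2 - 1) / (32 * Real.pi) * (τ : ℂ) ^ 2
          + (-(7 / 128) + 13 / (6144 * Real.pi ^ 2) + Complex.I * Real.pi / 4
              - Real.pi ^ 2 / 32) * (τ : ℂ) ^ 4))
      =O[𝓝[>] 0] fun τ : ℝ => τ ^ 5 := by
  have hpi : (Real.pi : ℂ) ≠ 0 := by exact_mod_cast Real.pi_ne_zero
  set s₁ : ℂ := Real.pi * Complex.I * (1 / 4 + kap ^ 2 / 2) with hs₁
  set s₂ : ℂ := Real.pi * Complex.I * (1 / 4 + kap / 4 + kap ^ 3 / 6) with hs₂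
  set w : ℝ → ℂ := fun τ => (τ : ℂ) ^ 2 with hw
  -- The quotient tends to `1`; removing this limit produces `exp (π i) = -1`, which absorbs the
  -- sign, so that `E = exp s` with `s = O(τ²)`.
  set s : ℝ → ℂ := fun τ => Real.pi * Complex.I * (scaledExponent (w τ) / w τ - 1) with hs
  have hwt : Tendsto w (𝓝[>] 0) (𝓝 0) := tendsto_ofReal_sq
  have hw0 : ∀ᶠ τ : ℝ in 𝓝[>] 0, w τ ≠ 0 := by
    filter_upwards [self_mem_nhdsWithin] with τ hτ
    exact pow_ne_zero 2 (by exact_mod_cast (Set.mem_Ioi.1 hτ).ne')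
  have hO2 : ∀ {a b : ℕ}, b ≤ a → (fun τ => w τ ^ a) =O[𝓝[>] 0] fun τ => w τ ^ b := by
    intro a b hab
    have h1 : (fun x : ℂ => x ^ a) =O[𝓝 0] fun x => x ^ b :=
      isBigO_pow_of_eventually_eq (R := fun x => x ^ (a - b)) (by fun_prop)
        (Eventually.of_forall fun x => (pow_mul_pow_sub x hab).symm)
    exact h1.comp_tendsto hwt
  have h3 : (fun τ => s τ - (s₁ * w τ + s₂ * w τ ^ 2)) =O[𝓝[>] 0] fun τ => w τ ^ 3 := by
    have h1 := ((scaledExponent_expansion.comp_tendsto hwt).mul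
      (isBigO_refl (fun τ => (w τ)⁻¹) (𝓝[>] 0))).const_mul_left (Real.pi * Complex.I)
    refine h1.congr' ?_ ?_
    · filter_upwards [hw0] with τ h0
      simp only [Function.comp, hs, hs₁, hs₂]
      field_simp
      ring
    · filter_upwards [hw0] with τ h0
      simp only [Function.comp]
      field_simp
  have h2 : (fun τ => s τ - s₁ * w τ) =O[𝓝[>] 0] fun τ => w τ ^ 2 := by
    refine ((h3.trans (hO2 (by norm_num))).add
      ((isBigO_refl (fun τ => w τ ^ 2) _).const_mul_left s₂)).congr_left fun τ => ?_
    ring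
  have h1 : s =O[𝓝[>] 0] fun τ => w τ ^ 1 := by
    refine ((h2.trans (hO2 (by norm_num))).add
      ((isBigO_refl (fun τ => w τ ^ 1) _).const_mul_left s₁)).congr_left fun τ => ?_
    ring
  have hst : Tendsto s (𝓝[>] 0) (𝓝 0) :=
    h1.trans_tendsto (by simpa using hwt)
  have hsq : (fun τ => s τ ^ 2 - s₁ ^ 2 * w τ ^ 2) =O[𝓝[>] 0] fun τ => w τ ^ 3 := by
    have h4 : (fun τ => s τ + s₁ * w τ) =O[𝓝[>] 0] fun τ => w τ ^ 1 := by
      refine (h1.add ((isBigO_refl (fun τ => w τ ^ 1) _).const_mul_left s₁)).congr_left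
        fun τ => ?_
      ring
    refine (h2.mul h4).congr (fun τ => by ring) fun τ => by ring
  have hexp : (fun τ => Complex.exp (s τ) - (1 + s τ + s τ ^ 2 / 2)) =O[𝓝[>] 0]
      fun τ => w τ ^ 3 := by
    have h4 := (Complex.exp_sub_sum_range_isBigO_pow 3).comp_tendsto hst
    have h5 : (fun τ => s τ ^ 3) =O[𝓝[>] 0] fun τ => w τ ^ 3 := by simpa using h1.pow 3
    refine (h4.trans h5).congr_left fun τ => ?_
    simp [Finset.sum_range_succ, Nat.factorial]
  have hmain : (fun τ => Complex.exp (s τ) - (1 + s₁ * w τ + (s₂ + s₁ ^ 2 / 2) * w τ ^ 2))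
      =O[𝓝[>] 0] fun τ => w τ ^ 3 := by
    refine ((hexp.add h3).add (hsq.const_mul_left (1 / 2))).congr_left fun τ => ?_
    ring
  have hfin : (fun τ => w τ ^ 3) =O[𝓝[>] 0] fun τ : ℝ => τ ^ 5 :=
    isBigO_comp_sq (f := fun w => w ^ 3) (n := 3) (by norm_num) (isBigO_refl _ _)
      (Eventually.of_forall fun τ => rfl)
  refine (hmain.trans hfin).congr' ?_ EventuallyEq.rfl
  have hk2 : kap ^ 2 = -(1 / (16 * Real.pi ^ 2)) := by
    rw [kap, div_pow, Complex.I_sq]; ring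
  have hk3 : kap ^ 3 = -(Complex.I / (64 * Real.pi ^ 3)) := by
    rw [pow_succ, hk2, kap]; ring
  have c1 : s₁ = Complex.I * (8 * Real.pi ^ 2 - 1) / (32 * Real.pi) := by
    rw [hs₁, hk2]; field_simp; ring
  have c2 : s₂ + s₁ ^ 2 / 2 = -(7 / 128) + 13 / (6144 * Real.pi ^ 2) + Complex.I * Real.pi / 4
              - Real.pi ^ 2 / 32 := by
    rw [c1, hs₂, hk3, kap]
    field_simp
    ring_nf
    simp only [Complex.I_sq]
    ring
  filter_upwards [E_eq, hw0] with τ h h0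
  rw [h, ← c1, ← c2]
  have : Real.pi * Complex.I * (scaledExponent ((τ : ℂ) ^ 2) / (τ : ℂ) ^ 2)
      = s τ + Real.pi * Complex.I := by
    simp only [hs, hw]; ring
  rw [this, Complex.exp_add, Complex.exp_pi_mul_I]
  simp only [hw]
  ring

lemma E_isPowerSeriesNearZero : IsPowerSeriesNearZero E 1 := by
  obtain ⟨g, hg, hge⟩ := E_analytic_aux
  refine ⟨g, hg, ?_, hge⟩
  -- The constant term of `g` is read off by comparing its limit at `0` with that given by the
  -- expansion of `E`.
  have hto : Tendsto (fun τ : ℝ => (τ : ℂ)) (𝓝[>] 0) (𝓝 0) := by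
    simpa using (Complex.continuous_ofReal.tendsto 0).mono_left nhdsWithin_le_nhds
  have h1 : Tendsto (fun τ : ℝ => g (τ : ℂ)) (𝓝[>] 0) (𝓝 (g 0)) :=
    hg.continuousAt.tendsto.comp hto
  have h5 : Tendsto (fun τ : ℝ => τ ^ 5) (𝓝[>] 0) (𝓝 0) := by
    simpa using ((continuous_pow 5).tendsto (0 : ℝ)).mono_left nhdsWithin_le_nhds
  have h2 := E_expansion.trans_tendsto h5
  have h3 : Tendsto (fun τ : ℝ => 1 + Complex.I * (8 * Real.pi ^ 2 - 1) / (32 * Real.pi)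
          * (τ : ℂ) ^ 2 + (-(7 / 128) + 13 / (6144 * Real.pi ^ 2) + Complex.I * Real.pi / 4
              - Real.pi ^ 2 / 32) * (τ : ℂ) ^ 4) (𝓝[>] 0) (𝓝 1) := by
    simpa using ((hto.pow 2).const_mul _).const_add 1 |>.add ((hto.pow 4).const_mul _)
  have h4 : Tendsto E (𝓝[>] 0) (𝓝 1) := by simpa using h2.add h3
  exact tendsto_nhds_unique (h1.congr' (hge.mono fun _ h => h.symm)) h4

/-! ### The coefficients `F_m`: formal series and Gaussian moments -/

lemma eps_sq : eps ^ 2 = Complex.I := by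
  rw [eps, ← Complex.exp_nat_mul,
    show ((2 : ℕ) : ℂ) * (Real.pi * Complex.I / 4) = Real.pi / 2 * Complex.I by push_cast; ring,
    Complex.exp_pi_div_two_mul_I]

lemma eps_pow_four : eps ^ 4 = -1 := by
  rw [show eps ^ 4 = (eps ^ 2) ^ 2 by ring, eps_sq, Complex.I_sq]

lemma eps_ne_zero : eps ≠ 0 := Complex.exp_ne_zero _

lemma norm_eps : ‖eps‖ = 1 := by
  have : eps = Complex.exp (((Real.pi / 4 : ℝ) : ℂ) * Complex.I) := by
    rw [eps]; congr 1; push_cast; ring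
  rw [this, Complex.norm_exp_ofReal_mul_I]

/-- The scalar coefficients of `phaseSeries`. -/
def phaseScalar (τ : ℝ) (j : ℕ) : ℂ :=
  if j = 0 then 0
  else -(Real.pi * Complex.I) * A (j + 2) τ * eps ^ (3 * (j + 2)) / ((j : ℂ) + 2)

lemma coeff_phaseSeries (τ : ℝ) (j : ℕ) : PowerSeries.coeff j (phaseSeries τ) =
    Polynomial.C (phaseScalar τ j) * Polynomial.X ^ (j + 2) := by
  rw [phaseSeries, PowerSeries.coeff_mk, phaseScalar]
  split_ifs <;> simp

/-- Homogeneity: each factor `u^j` carries `y^(j + 2)`, so a product of `k` factors of total order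
`m` carries `y^(m + 2 k)`. The power of `y` thus has the parity of `m`, which makes odd orders
vanish. -/
lemma coeff_phaseSeries_pow (τ : ℝ) (k : ℕ) : ∀ m, PowerSeries.coeff m (phaseSeries τ ^ k) =
    Polynomial.C (PowerSeries.coeff m (PowerSeries.mk (phaseScalar τ) ^ k))
      * Polynomial.X ^ (m + 2 * k) := by
  induction k with
  | zero =>
    intro m
    simp only [pow_zero, PowerSeries.coeff_one]
    split_ifs with h <;> simp [h]
  | succ k ih =>
    intro m
    rw [pow_succ, pow_succ, PowerSeries.coeff_mul, PowerSeries.coeff_mul, map_sum, Finset.sum_mul]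
    refine Finset.sum_congr rfl fun x hx => ?_
    rw [Finset.HasAntidiagonal.mem_antidiagonal] at hx
    rw [ih, coeff_phaseSeries, PowerSeries.coeff_mk, map_mul, ← hx]
    ring

/-- Termwise replacement of `y ^ n` by the normalised moment. -/
def momentFunctional (τ : ℝ) : Polynomial ℂ →+ ℂ where
  toFun p := p.sum fun n c => c * moment τ n
  map_zero' := Polynomial.sum_zero_index _
  map_add' p q := Polynomial.sum_add_index p q _ (fun _ => zero_mul _) (fun _ _ _ => add_mul _ _ _)

lemma Fcoeff_eq (m : ℕ) (τ : ℝ) : Fcoeff m τ = momentFunctional τ (expansionCoeff τ m) := rfl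

lemma momentFunctional_C_mul_X_pow (τ : ℝ) (c : ℂ) (n : ℕ) :
    momentFunctional τ (Polynomial.C c * Polynomial.X ^ n) = c * moment τ n := by
  rw [Polynomial.C_mul_X_pow_eq_monomial]
  exact Polynomial.sum_monomial_index (f := fun n c => c * moment τ n) _ (zero_mul (moment τ n))

/-- The contribution of the constant term of the amplitude to `Fcoeff`. -/
def phaseMoment (τ : ℝ) (M m : ℕ) : ℂ :=
  ∑ k ∈ Finset.range (M + 1), 1 / (k.factorial : ℂ)
    * PowerSeries.coeff m (PowerSeries.mk (phaseScalar τ) ^ k) * moment τ (m + 2 * k)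

lemma momentFunctional_coeff_exp (τ : ℝ) (M m : ℕ) :
    momentFunctional τ (PowerSeries.coeff m (∑ k ∈ Finset.range (M + 1),
      PowerSeries.C (Polynomial.C (1 / (k.factorial : ℂ))) * phaseSeries τ ^ k))
      = phaseMoment τ M m := by
  rw [map_sum, map_sum, phaseMoment]
  refine Finset.sum_congr rfl fun k _ => ?_
  rw [PowerSeries.coeff_C_mul, coeff_phaseSeries_pow, ← mul_assoc, ← map_mul,
    momentFunctional_C_mul_X_pow]

lemma coeff_ampSeries_zero (τ : ℝ) : PowerSeries.coeff 0 (ampSeries τ) = 1 := by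
  simp [ampSeries]

lemma coeff_ampSeries_of_lt (τ : ℝ) {j : ℕ} (h0 : j ≠ 0) (h5 : j < 5) :
    PowerSeries.coeff j (ampSeries τ) = 0 := by
  simp [ampSeries, h0, not_le.2 h5]

lemma Fcoeff_of_lt_five (τ : ℝ) {m : ℕ} (hm : m < 5) : Fcoeff m τ = phaseMoment τ m m := by
  rw [Fcoeff_eq, expansionCoeff, PowerSeries.coeff_mul, ← momentFunctional_coeff_exp τ m m,
    Finset.sum_eq_single (0, m)]
  · rw [coeff_ampSeries_zero, one_mul]
  · rintro ⟨i, j⟩ hij hne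
    rw [Finset.HasAntidiagonal.mem_antidiagonal] at hij
    simp only at hij
    rw [coeff_ampSeries_of_lt τ ?_ (by omega), zero_mul]
    rintro rfl
    exact hne (by simp at hij; simp [hij])
  · simp

lemma moment_zero (τ : ℝ) : moment τ 0 = 1 := by
  have hs : (Real.sqrt Real.pi : ℂ) ≠ 0 := by
    exact_mod_cast (Real.sqrt_pos.2 Real.pi_pos).ne'
  have hG : Real.Gamma 2⁻¹ = Real.sqrt Real.pi := by rw [← one_div, Real.Gamma_one_half_eq]
  simp [moment, hG, hs]

lemma moment_odd (τ : ℝ) {n : ℕ} (hn : Odd n) : moment τ n = 0 := by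
  rw [moment, if_neg (Nat.not_even_iff_odd.2 hn)]

/-- The form `(2 j - 1)!! / (π A₂)^j` makes the rational coefficients of `F₂` and `F₄` visible. It
also holds when `A₂ = 0`, by the convention for division by zero. -/
lemma moment_two_mul (τ : ℝ) (j : ℕ) : moment τ (2 * j) =
    ((2 * j - 1).doubleFactorial : ℂ) / (Real.pi * A 2 τ) ^ j := by
  have h : ((2 * j : ℕ) + 1 : ℝ) / 2 = j + 1 / 2 := by push_cast; ring
  have hs : Real.sqrt Real.pi ≠ 0 := (Real.sqrt_pos.2 Real.pi_pos).ne'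
  rw [moment, if_pos (even_two_mul j), h, Real.Gamma_nat_add_half,
    Nat.mul_div_cancel_left _ two_pos, div_pow]
  have h2 : ((2 * j - 1).doubleFactorial : ℝ) * Real.sqrt Real.pi / 2 ^ j / Real.sqrt Real.pi
      = (2 * j - 1).doubleFactorial / 2 ^ j := by field_simp
  rw [h2]
  push_cast
  rcases eq_or_ne ((Real.pi : ℂ) * A 2 τ) 0 with h0 | h0
  · rw [h0]
    rcases j with _ | j <;> simp
  · field_simp

lemma phaseMoment_odd (τ : ℝ) (M : ℕ) {m : ℕ} (hm : Odd m) : phaseMoment τ M m = 0 := by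
  refine Finset.sum_eq_zero fun k _ => ?_
  rw [moment_odd τ (hm.add_even (even_two_mul k)), mul_zero]

lemma phaseMoment_zero (τ : ℝ) (M : ℕ) : phaseMoment τ M 0 = 1 := by
  rw [phaseMoment, Finset.sum_eq_single 0]
  · simp [moment_zero]
  · intro k _ hk
    have : PowerSeries.constantCoeff (PowerSeries.mk (phaseScalar τ)) = 0 := by
      simp [← PowerSeries.coeff_zero_eq_constantCoeff_apply, phaseScalar]
    simp [this, hk]
  · simp

/-- The amplitude first enters at order `u⁵`, with a constant in `y`. The remaining contribution
comes from the phase alone, has odd order, and vanishes. -/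
lemma Fcoeff_five (τ : ℝ) : Fcoeff 5 τ = eps ^ 3 / 4 * B 0 τ := by
  have h5 : PowerSeries.coeff 5 (ampSeries τ) = Polynomial.C (eps ^ 3 / 4 * B 0 τ) := by
    simp [ampSeries]
  have key : ∀ S : PowerSeries (Polynomial ℂ), PowerSeries.coeff 0 S = 1 →
      momentFunctional τ (PowerSeries.coeff 5 S) = 0 →
      momentFunctional τ (PowerSeries.coeff 5 (ampSeries τ * S)) = eps ^ 3 / 4 * B 0 τ := by
    intro S h0 h1
    rw [PowerSeries.coeff_mul, Finset.Nat.sum_antidiagonal_eq_sum_range_succ_mk]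
    simp only [Finset.sum_range_succ, Finset.sum_range_zero, coeff_ampSeries_zero, h5,
      coeff_ampSeries_of_lt τ one_ne_zero (by norm_num : 1 < 5),
      coeff_ampSeries_of_lt τ two_ne_zero (by norm_num : 2 < 5),
      coeff_ampSeries_of_lt τ three_ne_zero (by norm_num : 3 < 5),
      coeff_ampSeries_of_lt τ four_ne_zero (by norm_num : 4 < 5), zero_mul, add_zero, zero_add,
      one_mul, Nat.sub_zero, Nat.sub_self, map_add, h0, h1]
    have := momentFunctional_C_mul_X_pow τ (eps ^ 3 / 4 * B 0 τ) 0
    simpa only [moment_zero, pow_zero, mul_one] using this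
  refine key _ ?_ ?_
  · rw [map_sum, Finset.sum_eq_single 0]
    · simp
    · intro k _ hk
      rw [PowerSeries.coeff_C_mul]
      have : PowerSeries.constantCoeff (phaseSeries τ) = 0 := by
        simp [← PowerSeries.coeff_zero_eq_constantCoeff_apply, phaseSeries]
      simp [this, hk]
    · simp
  · rw [momentFunctional_coeff_exp, phaseMoment_odd τ 5 (by decide)]

lemma Fcoeff_two (τ : ℝ) : Fcoeff 2 τ =
    3 * Complex.I * A 4 τ / (4 * Real.pi * A 2 τ ^ 2)
      - 5 * Complex.I * A 3 τ ^ 2 / (6 * Real.pi * A 2 τ ^ 3) := by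
  have hpi : (Real.pi : ℂ) ≠ 0 := by exact_mod_cast Real.pi_ne_zero
  have h2 : PowerSeries.coeff 2 (PowerSeries.mk (phaseScalar τ) ^ 2) = phaseScalar τ 1 ^ 2 := by
    simp [pow_succ, PowerSeries.coeff_mul, Finset.Nat.antidiagonal_succ, phaseScalar]
  have h1 : PowerSeries.coeff 2 (PowerSeries.mk (phaseScalar τ) ^ 1) = phaseScalar τ 2 := by
    simp
  have h0 : PowerSeries.coeff 2 (PowerSeries.mk (phaseScalar τ) ^ 0) = 0 := by
    simp [PowerSeries.coeff_one]
  have e9 : eps ^ 9 = eps := by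
    rw [show eps ^ 9 = (eps ^ 4) ^ 2 * eps by ring, eps_pow_four]; ring
  have e12 : eps ^ 12 = -1 := by
    rw [show eps ^ 12 = (eps ^ 4) ^ 3 by ring, eps_pow_four]; ring
  rw [Fcoeff_of_lt_five τ (by norm_num), phaseMoment]
  simp only [Finset.sum_range_succ, Finset.sum_range_zero, h0, h1, h2]
  rw [show 2 + 2 * 1 = 2 * 2 from rfl, show 2 + 2 * 2 = 2 * 3 from rfl, moment_two_mul,
    moment_two_mul]
  simp [phaseScalar, Nat.doubleFactorial, Nat.factorial, e9, e12]
  rw [div_pow, neg_sq, mul_pow _ eps, eps_sq]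
  -- The formula is asserted for every `τ`, so `A₂ = 0` cannot be excluded; both sides are then `0`.
  rcases eq_or_ne (A 2 τ) 0 with h | h
  · simp [h]
  · field_simp
    ring_nf
    simp
    ring

lemma Fcoeff_four (τ : ℝ) : Fcoeff 4 τ =
    -(385 * A 3 τ ^ 4 / (72 * Real.pi ^ 2 * A 2 τ ^ 6))
      + 105 * A 4 τ * A 3 τ ^ 2 / (8 * Real.pi ^ 2 * A 2 τ ^ 5)
      - 7 * A 5 τ * A 3 τ / (Real.pi ^ 2 * A 2 τ ^ 4)
      - 105 * A 4 τ ^ 2 / (32 * Real.pi ^ 2 * A 2 τ ^ 4)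
      + 5 * A 6 τ / (2 * Real.pi ^ 2 * A 2 τ ^ 3) := by
  have hpi : (Real.pi : ℂ) ≠ 0 := by exact_mod_cast Real.pi_ne_zero
  have hz : phaseScalar τ 0 = 0 := by simp [phaseScalar]
  have h4 : PowerSeries.coeff 4 (PowerSeries.mk (phaseScalar τ) ^ 4) = phaseScalar τ 1 ^ 4 := by
    simp [pow_succ, PowerSeries.coeff_mul, Finset.Nat.antidiagonal_succ, hz]
  have h3 : PowerSeries.coeff 4 (PowerSeries.mk (phaseScalar τ) ^ 3) =
      3 * phaseScalar τ 1 ^ 2 * phaseScalar τ 2 := by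
    simp [pow_succ, PowerSeries.coeff_mul, Finset.Nat.antidiagonal_succ, hz]
    ring
  have h2 : PowerSeries.coeff 4 (PowerSeries.mk (phaseScalar τ) ^ 2) =
      2 * phaseScalar τ 1 * phaseScalar τ 3 + phaseScalar τ 2 ^ 2 := by
    simp [pow_succ, PowerSeries.coeff_mul, Finset.Nat.antidiagonal_succ, hz]
    ring
  have h1 : PowerSeries.coeff 4 (PowerSeries.mk (phaseScalar τ) ^ 1) = phaseScalar τ 4 := by
    simp
  have h0 : PowerSeries.coeff 4 (PowerSeries.mk (phaseScalar τ) ^ 0) = 0 := by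
    simp [PowerSeries.coeff_one]
  have e9 : eps ^ 9 = eps := by
    rw [show eps ^ 9 = (eps ^ 4) ^ 2 * eps by ring, eps_pow_four]; ring
  have e12 : eps ^ 12 = -1 := by
    rw [show eps ^ 12 = (eps ^ 4) ^ 3 by ring, eps_pow_four]; ring
  have e15 : eps ^ 15 = -Complex.I * eps := by
    rw [show eps ^ 15 = (eps ^ 4) ^ 3 * eps ^ 2 * eps by ring, eps_pow_four, eps_sq]; ring
  have e18 : eps ^ 18 = Complex.I := by
    rw [show eps ^ 18 = (eps ^ 4) ^ 4 * eps ^ 2 by ring, eps_pow_four, eps_sq]; ring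
  have p1 : phaseScalar τ 1 = -(Real.pi * Complex.I) * A 3 τ * eps / 3 := by
    norm_num [phaseScalar, e9]
  have p2 : phaseScalar τ 2 = Real.pi * Complex.I * A 4 τ / 4 := by
    norm_num [phaseScalar, e12]
  have p3 : phaseScalar τ 3 = -(Real.pi * A 5 τ * eps) / 5 := by
    norm_num [phaseScalar, e15]
    linear_combination (Real.pi * A 5 τ * eps) * Complex.I_sq
  have p4 : phaseScalar τ 4 = Real.pi * A 6 τ / 6 := by
    norm_num [phaseScalar, e18]
    linear_combination (-(Real.pi * A 6 τ)) * Complex.I_sq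
  -- Every product occurring at order `4` has an even total power of `ε`, so `ε² = i` eliminates it.
  have q11 : phaseScalar τ 1 ^ 2 = -(Real.pi ^ 2 * A 3 τ ^ 2 * Complex.I / 9) := by
    rw [p1, div_pow, mul_pow, mul_pow, eps_sq, neg_sq, mul_pow, Complex.I_sq]; ring
  have q13 : phaseScalar τ 1 * phaseScalar τ 3 = -(Real.pi ^ 2 * A 3 τ * A 5 τ / 15) := by
    rw [p1, p3]
    linear_combination (Real.pi ^ 2 * A 3 τ * A 5 τ / 15) * (Complex.I * eps_sq + Complex.I_sq)
  have q1111 : phaseScalar τ 1 ^ 4 = -(Real.pi ^ 4 * A 3 τ ^ 4 / 81) := by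
    rw [show phaseScalar τ 1 ^ 4 = (phaseScalar τ 1 ^ 2) ^ 2 by ring, q11]
    linear_combination (Real.pi ^ 4 * A 3 τ ^ 4 / 81) * Complex.I_sq
  have q112 : phaseScalar τ 1 ^ 2 * phaseScalar τ 2 = Real.pi ^ 3 * A 3 τ ^ 2 * A 4 τ / 36 := by
    rw [q11, p2]
    linear_combination (-(Real.pi ^ 3 * A 3 τ ^ 2 * A 4 τ / 36)) * Complex.I_sq
  have q22 : phaseScalar τ 2 ^ 2 = -(Real.pi ^ 2 * A 4 τ ^ 2 / 16) := by
    rw [p2]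
    linear_combination (Real.pi ^ 2 * A 4 τ ^ 2 / 16) * Complex.I_sq
  rw [Fcoeff_of_lt_five τ (by norm_num), phaseMoment]
  simp only [Finset.sum_range_succ, Finset.sum_range_zero, h0, h1, h2, h3, h4, mul_assoc, q13,
    q112, q1111, q22, p4]
  rw [show 4 + 2 * 1 = 2 * 3 from rfl, show 4 + 2 * 2 = 2 * 4 from rfl,
    show 4 + 2 * 3 = 2 * 5 from rfl, show 4 + 2 * 4 = 2 * 6 from rfl]
  simp only [moment_two_mul]
  simp [Nat.doubleFactorial, Nat.factorial]
  rcases eq_or_ne (A 2 τ) 0 with h | h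
  · simp [h]
  · field_simp
    ring

/-! ### Weighted `ℓ¹` estimates for power series and `a * exp h` -/

/-- `S` converges absolutely at radius `r`, with weighted `ℓ¹`-norm at most `M`. -/
def WeightedBound (S : PowerSeries ℂ) (r M : ℝ) : Prop :=
  Summable (fun n => ‖PowerSeries.coeff n S‖ * r ^ n) ∧
    ∑' n, ‖PowerSeries.coeff n S‖ * r ^ n ≤ M

/-- The value at `u` of a power series. -/
def seriesValue (S : PowerSeries ℂ) (u : ℂ) : ℂ := ∑' n, PowerSeries.coeff n S * u ^ n

/-- The weighted `ℓ¹`-norm is submultiplicative, by the Cauchy product. -/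
lemma WeightedBound.mul {S T : PowerSeries ℂ} {r M N : ℝ} (hr : 0 ≤ r)
    (hS : WeightedBound S r M) (hT : WeightedBound T r N) : WeightedBound (S * T) r (M * N) := by
  have nS : ∀ n, 0 ≤ ‖PowerSeries.coeff n S‖ * r ^ n := fun n => by positivity
  have nT : ∀ n, 0 ≤ ‖PowerSeries.coeff n T‖ * r ^ n := fun n => by positivity
  have aS : Summable fun n => ‖‖PowerSeries.coeff n S‖ * r ^ n‖ := by
    simpa only [Real.norm_of_nonneg (nS _)] using hS.1
  have aT : Summable fun n => ‖‖PowerSeries.coeff n T‖ * r ^ n‖ := by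
    simpa only [Real.norm_of_nonneg (nT _)] using hT.1
  have hsum := (summable_norm_sum_mul_antidiagonal_of_summable_norm aS aT).of_norm
  have hle : ∀ n, ‖PowerSeries.coeff n (S * T)‖ * r ^ n ≤
      ∑ kl ∈ Finset.HasAntidiagonal.antidiagonal n,
        (‖PowerSeries.coeff kl.1 S‖ * r ^ kl.1) * (‖PowerSeries.coeff kl.2 T‖ * r ^ kl.2) := by
    intro n
    rw [PowerSeries.coeff_mul]
    refine (mul_le_mul_of_nonneg_right (norm_sum_le _ _) (by positivity)).trans_eq ?_
    rw [Finset.sum_mul]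
    refine Finset.sum_congr rfl fun x hx => ?_
    rw [norm_mul, ← Finset.HasAntidiagonal.mem_antidiagonal.1 hx, pow_add]
    ring
  have hs : Summable fun n => ‖PowerSeries.coeff n (S * T)‖ * r ^ n :=
    Summable.of_nonneg_of_le (fun n => by positivity) hle hsum
  refine ⟨hs, (hs.tsum_le_tsum hle hsum).trans ?_⟩
  rw [← tsum_mul_tsum_eq_tsum_sum_antidiagonal_of_summable_norm aS aT]
  exact mul_le_mul hS.2 hT.2 (tsum_nonneg nT) ((tsum_nonneg nS).trans hS.2)

lemma WeightedBound.summable_norm {S : PowerSeries ℂ} {r M : ℝ} (hS : WeightedBound S r M)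
    {u : ℂ} (hu : ‖u‖ ≤ r) : Summable fun n => ‖PowerSeries.coeff n S * u ^ n‖ := by
  refine Summable.of_nonneg_of_le (fun n => norm_nonneg _) (fun n => ?_) hS.1
  rw [norm_mul, norm_pow]
  gcongr

lemma seriesValue_mul {S T : PowerSeries ℂ} {r M N : ℝ}
    (hS : WeightedBound S r M) (hT : WeightedBound T r N) {u : ℂ} (hu : ‖u‖ ≤ r) :
    seriesValue (S * T) u = seriesValue S u * seriesValue T u := by
  rw [seriesValue, seriesValue, seriesValue,
    tsum_mul_tsum_eq_tsum_sum_antidiagonal_of_summable_norm (hS.summable_norm hu)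
      (hT.summable_norm hu)]
  congr 1
  ext n
  rw [PowerSeries.coeff_mul, Finset.sum_mul]
  refine Finset.sum_congr rfl fun x hx => ?_
  rw [← Finset.HasAntidiagonal.mem_antidiagonal.1 hx, pow_add]
  ring

lemma weightedBound_one (r : ℝ) : WeightedBound 1 r 1 := by
  have h : HasSum (fun n => ‖PowerSeries.coeff n (1 : PowerSeries ℂ)‖ * r ^ n) 1 := by
    convert! hasSum_single (f := fun n => ‖PowerSeries.coeff n (1 : PowerSeries ℂ)‖ * r ^ n) 0
      fun n hn => by simp [PowerSeries.coeff_one, hn]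
    simp
  exact ⟨h.summable, h.tsum_eq.le⟩

lemma seriesValue_one (u : ℂ) : seriesValue 1 u = 1 := by
  rw [seriesValue, tsum_eq_single 0 fun n hn => by simp [PowerSeries.coeff_one, hn]]
  simp

lemma WeightedBound.pow {S : PowerSeries ℂ} {r M : ℝ} (hr : 0 ≤ r) (hS : WeightedBound S r M) :
    ∀ k : ℕ, WeightedBound (S ^ k) r (M ^ k)
  | 0 => by simpa using weightedBound_one r
  | k + 1 => by simpa only [pow_succ] using (hS.pow hr k).mul hr hS

lemma seriesValue_pow {S : PowerSeries ℂ} {r M : ℝ} (hS : WeightedBound S r M) {u : ℂ}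
    (hu : ‖u‖ ≤ r) : ∀ k : ℕ, seriesValue (S ^ k) u = seriesValue S u ^ k
  | 0 => by simpa using seriesValue_one u
  | k + 1 => by
    rw [pow_succ, pow_succ, seriesValue_mul (hS.pow ((norm_nonneg u).trans hu) k) hS hu,
      seriesValue_pow hS hu k]

/-- For `n ≥ N` and `u ≤ r`, `u^n ≤ (u / r)^N r^n`. -/
lemma WeightedBound.tail {S : PowerSeries ℂ} {r M : ℝ} (hr : 0 < r) (hS : WeightedBound S r M)
    {u : ℝ} (hu0 : 0 ≤ u) (hu : u ≤ r) (N : ℕ) :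
    ‖seriesValue S u - ∑ m ∈ Finset.range N, PowerSeries.coeff m S * (u : ℂ) ^ m‖
      ≤ (u / r) ^ N * M := by
  have hun : ‖(u : ℂ)‖ ≤ r := by rwa [Complex.norm_real, Real.norm_of_nonneg hu0]
  have hsn := hS.summable_norm hun
  have h1 := hsn.of_norm.sum_add_tsum_nat_add N
  rw [seriesValue, ← h1, add_sub_cancel_left]
  have hle : ∀ n, ‖PowerSeries.coeff (n + N) S * (u : ℂ) ^ (n + N)‖ ≤
      (u / r) ^ N * (‖PowerSeries.coeff (n + N) S‖ * r ^ (n + N)) := by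
    intro n
    rw [norm_mul, norm_pow, Complex.norm_real, Real.norm_of_nonneg hu0]
    have : u ^ (n + N) ≤ (u / r) ^ N * r ^ (n + N) := by
      have e : u ^ (n + N) = (u / r) ^ N * (u ^ n * r ^ N) := by
        rw [div_pow, pow_add]; field_simp
      rw [e, pow_add r]
      gcongr
    calc _ ≤ ‖PowerSeries.coeff (n + N) S‖ * ((u / r) ^ N * r ^ (n + N)) := by gcongr
      _ = _ := by ring
  have hs2 := ((summable_nat_add_iff N).2 hS.1).mul_left ((u / r) ^ N)
  refine (tsum_of_norm_bounded hs2.hasSum hle).trans ?_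
  rw [tsum_mul_left]
  refine mul_le_mul_of_nonneg_left ?_ (by positivity)
  refine le_trans ?_ hS.2
  rw [← hS.1.sum_add_tsum_nat_add N]
  exact le_add_of_nonneg_left (Finset.sum_nonneg fun n _ => by positivity)

/-- Counterpart of `WeightedBound.tail`: for `m < N` and `u ≥ r`, `u^m ≤ (u / r)^N r^m`, which gives
the same bound. -/
lemma WeightedBound.partialSum_le {S : PowerSeries ℂ} {r M : ℝ} (hr : 0 < r)
    (hS : WeightedBound S r M) {u : ℝ} (hu : r ≤ u) (N : ℕ) :
    ‖∑ m ∈ Finset.range N, PowerSeries.coeff m S * (u : ℂ) ^ m‖ ≤ (u / r) ^ N * M := by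
  have hu0 : 0 < u := hr.trans_le hu
  have h1 : 1 ≤ u / r := (one_le_div hr).2 hu
  calc _ ≤ ∑ m ∈ Finset.range N, (u / r) ^ N * (‖PowerSeries.coeff m S‖ * r ^ m) := by
        refine (norm_sum_le _ _).trans (Finset.sum_le_sum fun m hm => ?_)
        rw [norm_mul, norm_pow, Complex.norm_real, Real.norm_of_nonneg hu0.le]
        have e : u ^ m = (u / r) ^ m * r ^ m := by rw [div_pow]; field_simp
        have : u ^ m ≤ (u / r) ^ N * r ^ m := by
          rw [e]
          have := pow_le_pow_right₀ h1 (Finset.mem_range.1 hm).le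
          gcongr
        calc _ ≤ ‖PowerSeries.coeff m S‖ * ((u / r) ^ N * r ^ m) := by gcongr
          _ = _ := by ring
    _ ≤ (u / r) ^ N * M := by
        rw [← Finset.mul_sum]
        refine mul_le_mul_of_nonneg_left ?_ (by positivity)
        exact (hS.1.sum_le_tsum _ fun n _ => by positivity).trans hS.2

/-- The coefficients of `a * exp h` for a power series `h` without constant term. -/
def mulExpCoeff (a h : PowerSeries ℂ) (m : ℕ) : ℂ :=
  PowerSeries.coeff m (a * ∑ k ∈ Finset.range (m + 1),
    PowerSeries.C (1 / (k.factorial : ℂ)) * h ^ k)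

lemma coeff_mul_pow_eq_zero (a : PowerSeries ℂ) {h : PowerSeries ℂ}
    (h0 : PowerSeries.constantCoeff h = 0) {m k : ℕ} (hmk : m < k) :
    PowerSeries.coeff m (a * h ^ k) = 0 := by
  have : (PowerSeries.X : PowerSeries ℂ) ^ k ∣ a * h ^ k :=
    Dvd.dvd.mul_left (pow_dvd_pow_of_dvd (PowerSeries.X_dvd_iff.2 h0) k) a
  exact PowerSeries.X_pow_dvd_iff.1 this m hmk

/-- `h^k` is divisible by `X^k`, so the truncation of the exponential, which depends on `m`, may be
replaced by a common one for all `m < N`. -/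
lemma mulExpCoeff_eq (a : PowerSeries ℂ) {h : PowerSeries ℂ}
    (h0 : PowerSeries.constantCoeff h = 0) {m N : ℕ} (hm : m < N) :
    mulExpCoeff a h m = ∑ k ∈ Finset.range N,
      1 / (k.factorial : ℂ) * PowerSeries.coeff m (a * h ^ k) := by
  have h1 : mulExpCoeff a h m = ∑ k ∈ Finset.range (m + 1),
      1 / (k.factorial : ℂ) * PowerSeries.coeff m (a * h ^ k) := by
    rw [mulExpCoeff, Finset.mul_sum, map_sum]
    refine Finset.sum_congr rfl fun k _ => ?_
    rw [mul_left_comm, PowerSeries.coeff_C_mul]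
  rw [h1]
  refine Finset.sum_subset (Finset.range_subset_range.2 hm) fun k _ hk => ?_
  rw [coeff_mul_pow_eq_zero a h0 (by simpa using hk), mul_zero]

lemma sum_mulExpCoeff (a : PowerSeries ℂ) {h : PowerSeries ℂ}
    (h0 : PowerSeries.constantCoeff h = 0) (N : ℕ) (u : ℂ) :
    ∑ m ∈ Finset.range N, mulExpCoeff a h m * u ^ m =
      ∑ k ∈ Finset.range N, 1 / (k.factorial : ℂ) *
        ∑ m ∈ Finset.range N, PowerSeries.coeff m (a * h ^ k) * u ^ m := by
  simp_rw [Finset.mul_sum]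
  rw [Finset.sum_comm]
  refine Finset.sum_congr rfl fun m hm => ?_
  rw [mulExpCoeff_eq a h0 (Finset.mem_range.1 hm), Finset.sum_mul]
  exact Finset.sum_congr rfl fun k _ => mul_assoc _ _ _

lemma hasSum_pow_div_factorial_mul (M H c : ℝ) :
    HasSum (fun k : ℕ => 1 / (k.factorial : ℝ) * (c * (M * H ^ k))) (c * (M * Real.exp H)) := by
  have h1 : HasSum (fun k : ℕ => H ^ k / (k.factorial : ℝ)) (Real.exp H) := by
    rw [Real.exp_eq_exp_ℝ]
    exact NormedSpace.expSeries_div_hasSum_exp H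
  rw [← mul_assoc]
  refine (h1.mul_left (c * M)).congr_fun fun k => ?_
  ring

/-- The Taylor remainder of `a * exp h` inside the radius of absolute convergence. -/
theorem norm_mul_exp_sub_le {a h : PowerSeries ℂ} (h0 : PowerSeries.constantCoeff h = 0)
    {r M H : ℝ} (hr : 0 < r) (ha : WeightedBound a r M) (hh : WeightedBound h r H)
    {u : ℝ} (hu0 : 0 ≤ u) (hu : u ≤ r) (N : ℕ) :
    ‖seriesValue a u * Complex.exp (seriesValue h u)
      - ∑ m ∈ Finset.range N, mulExpCoeff a h m * (u : ℂ) ^ m‖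
      ≤ (u / r) ^ N * (M * Real.exp H) := by
  have hun : ‖(u : ℂ)‖ ≤ r := by rwa [Complex.norm_real, Real.norm_of_nonneg hu0]
  have hb := fun k => ha.mul hr.le (hh.pow hr.le k)
  rw [sum_mulExpCoeff a h0]
  have e1 : HasSum (fun k : ℕ => 1 / (k.factorial : ℂ) * seriesValue (a * h ^ k) u)
      (seriesValue a u * Complex.exp (seriesValue h u)) := by
    have h1 : HasSum (fun k : ℕ => seriesValue h u ^ k / (k.factorial : ℂ))
        (Complex.exp (seriesValue h u)) := by
      rw [Complex.exp_eq_exp_ℂ]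
      exact NormedSpace.expSeries_div_hasSum_exp _
    refine (h1.mul_left (seriesValue a u)).congr_fun fun k => ?_
    rw [seriesValue_mul ha (hh.pow hr.le k) hun, seriesValue_pow hh hun]
    ring
  have e2 : HasSum (fun k : ℕ => 1 / (k.factorial : ℂ) *
        ∑ m ∈ Finset.range N, PowerSeries.coeff m (a * h ^ k) * (u : ℂ) ^ m)
      (∑ k ∈ Finset.range N, 1 / (k.factorial : ℂ) *
        ∑ m ∈ Finset.range N, PowerSeries.coeff m (a * h ^ k) * (u : ℂ) ^ m) := by
    refine hasSum_sum_of_ne_finset_zero fun k hk => ?_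
    rw [Finset.sum_eq_zero, mul_zero]
    intro m hm
    rw [coeff_mul_pow_eq_zero a h0 ((Finset.mem_range.1 hm).trans_le (by simpa using hk)),
      zero_mul]
  -- The tail estimate applied to each `a * h ^ k` bounds the `k`-th term by `(u / r)^N M H^k / k!`;
  -- summation over `k` gives `exp H`.
  refine (e1.sub e2).norm_le_of_bounded (hasSum_pow_div_factorial_mul M H ((u / r) ^ N))
    fun k => ?_
  rw [← mul_sub, norm_mul]
  have := (hb k).tail hr hu0 hu N
  have hk : ‖1 / (k.factorial : ℂ)‖ = 1 / (k.factorial : ℝ) := by simp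
  rw [hk]
  gcongr

/-- The Taylor polynomials of `a * exp h` outside the radius of absolute convergence. -/
theorem norm_sum_mulExpCoeff_le {a h : PowerSeries ℂ} (h0 : PowerSeries.constantCoeff h = 0)
    {r M H : ℝ} (hr : 0 < r) (ha : WeightedBound a r M) (hh : WeightedBound h r H)
    {u : ℝ} (hu : r ≤ u) (N : ℕ) :
    ‖∑ m ∈ Finset.range N, mulExpCoeff a h m * (u : ℂ) ^ m‖
      ≤ (u / r) ^ N * (M * Real.exp H) := by
  have hb := fun k => ha.mul hr.le (hh.pow hr.le k)
  rw [sum_mulExpCoeff a h0]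
  have hu0 : 0 < u := hr.trans_le hu
  have hs := hasSum_pow_div_factorial_mul M H ((u / r) ^ N)
  have hM : 0 ≤ M := (tsum_nonneg fun n => by positivity).trans ha.2
  have hH : 0 ≤ H := (tsum_nonneg fun n => by positivity).trans hh.2
  refine le_trans ?_ (sum_le_hasSum (Finset.range N) (fun k _ => by positivity) hs)
  refine (norm_sum_le _ _).trans (Finset.sum_le_sum fun k _ => ?_)
  rw [norm_mul]
  have := (hb k).partialSum_le hr hu N
  have hk : ‖1 / (k.factorial : ℂ)‖ = 1 / (k.factorial : ℝ) := by simp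
  rw [hk]
  gcongr

/-! ### Complex Gaussian integrals -/

lemma integrable_pow_mul_exp_neg_mul_sq {b : ℝ} (hb : 0 < b) (n : ℕ) :
    MeasureTheory.Integrable fun x : ℝ => x ^ n * Real.exp (-b * x ^ 2) := by
  have := integrable_rpow_mul_exp_neg_mul_sq hb (s := n)
    (by linarith [n.cast_nonneg (α := ℝ)])
  simpa only [Real.rpow_natCast] using this

lemma integrable_pow_mul_cexp_neg_mul_sq {b : ℂ} (hb : 0 < b.re) (n : ℕ) :
    MeasureTheory.Integrable fun x : ℝ => (x : ℂ) ^ n * Complex.exp (-b * (x : ℂ) ^ 2) := by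
  refine (integrable_pow_mul_exp_neg_mul_sq hb n).norm.mono'
    (Continuous.aestronglyMeasurable (by fun_prop)) (Eventually.of_forall fun x => ?_)
  rw [norm_mul, norm_cexp_neg_mul_sq, norm_pow, Complex.norm_real, norm_mul, norm_pow,
    Real.norm_of_nonneg (Real.exp_pos _).le]

/-- Integration by parts: the derivative of `x^(n+1) exp (-b x²)` has integral zero. -/
lemma integral_pow_add_two_mul_cexp {b : ℂ} (hb : 0 < b.re) (n : ℕ) :
    ∫ x : ℝ, (x : ℂ) ^ (n + 2) * Complex.exp (-b * (x : ℂ) ^ 2) =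
      (n + 1) / (2 * b) * ∫ x : ℝ, (x : ℂ) ^ n * Complex.exp (-b * (x : ℂ) ^ 2) := by
  have hb0 : b ≠ 0 := fun h => by simp [h] at hb
  have hd : ∀ x : ℝ, HasDerivAt (fun x : ℝ => (x : ℂ) ^ (n + 1) * Complex.exp (-b * (x : ℂ) ^ 2))
      ((n + 1) * ((x : ℂ) ^ n * Complex.exp (-b * (x : ℂ) ^ 2))
        - 2 * b * ((x : ℂ) ^ (n + 2) * Complex.exp (-b * (x : ℂ) ^ 2))) x := by
    intro x
    have h1 : HasDerivAt (fun z : ℂ => z ^ (n + 1) * Complex.exp (-b * z ^ 2))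
        (((n + 1 : ℕ) : ℂ) * (x : ℂ) ^ n * Complex.exp (-b * (x : ℂ) ^ 2)
          + (x : ℂ) ^ (n + 1) * (Complex.exp (-b * (x : ℂ) ^ 2) * (-b * (2 * (x : ℂ))))) x := by
      have h2 := ((hasDerivAt_pow 2 (x : ℂ)).const_mul (-b)).cexp
      have h3 := (hasDerivAt_pow (n + 1) (x : ℂ)).fun_mul h2
      simpa using h3
    refine h1.comp_ofReal.congr_deriv ?_
    push_cast
    ring
  have hi := ((integrable_pow_mul_cexp_neg_mul_sq hb n).const_mul ((n : ℂ) + 1))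
  have hi2 := ((integrable_pow_mul_cexp_neg_mul_sq hb (n + 2)).const_mul (2 * b))
  have h0 := MeasureTheory.integral_eq_zero_of_hasDerivAt_of_integrable hd (hi.sub hi2)
    (integrable_pow_mul_cexp_neg_mul_sq hb (n + 1))
  rw [MeasureTheory.integral_sub hi hi2, MeasureTheory.integral_const_mul,
    MeasureTheory.integral_const_mul, sub_eq_zero] at h0
  rw [div_mul_eq_mul_div, h0, mul_div_cancel_left₀]
  simpa using hb0

lemma integral_ofReal_mul_cexp (b : ℂ) :
    ∫ x : ℝ, (x : ℂ) ^ 1 * Complex.exp (-b * (x : ℂ) ^ 2) = 0 := by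
  have h := MeasureTheory.integral_neg_eq_self
    (fun x : ℝ => (x : ℂ) ^ 1 * Complex.exp (-b * (x : ℂ) ^ 2)) MeasureTheory.volume
  have h2 : ∀ x : ℝ, ((-x : ℝ) : ℂ) ^ 1 * Complex.exp (-b * ((-x : ℝ) : ℂ) ^ 2) =
      -((x : ℂ) ^ 1 * Complex.exp (-b * (x : ℂ) ^ 2)) := fun x => by push_cast; simp
  simp_rw [h2] at h
  rw [MeasureTheory.integral_neg] at h
  exact CharZero.eq_neg_self_iff.1 h.symm

lemma moment_add_two (τ : ℝ) (n : ℕ) :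
    moment τ (n + 2) = (n + 1) / (2 * (Real.pi * A 2 τ / 2)) * moment τ n := by
  unfold moment
  have he : Even (n + 2) ↔ Even n := by simp [Nat.even_add]
  simp only [he]
  split_ifs with h
  · have h1 : (((n + 2 : ℕ) : ℝ) + 1) / 2 = ((n : ℝ) + 1) / 2 + 1 := by push_cast; ring
    rw [h1, Real.Gamma_add_one (by positivity), show (n + 2) / 2 = n / 2 + 1 by omega, pow_succ]
    push_cast
    have : (n + 1 : ℂ) / (2 * (Real.pi * A 2 τ / 2)) =
      2 / (Real.pi * A 2 τ) * ((n + 1) / 2) := by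
      rcases eq_or_ne ((Real.pi : ℂ) * A 2 τ) 0 with h0 | h0
      · simp [h0]
      · field_simp
    rw [this]
    ring
  · simp

lemma moment_one (τ : ℝ) : moment τ 1 = 0 := moment_odd τ odd_one

/-- Both sides satisfy the same two-step recursion, so only `n = 0` and `n = 1` need checking. For
`n = 0`, `Re A₂ > 0` keeps `A₂` off the cut, and the principal root splits as `√2 / √A₂`. -/
lemma integral_pow_mul_cexp_eq_moment {τ : ℝ} (hA : 0 < (A 2 τ).re) (n : ℕ) :
    ∫ x : ℝ, (x : ℂ) ^ n * Complex.exp (-(Real.pi * A 2 τ / 2) * (x : ℂ) ^ 2) =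
      moment τ n * (Real.sqrt 2 / A 2 τ ^ (1 / 2 : ℂ)) := by
  have hA0 : A 2 τ ≠ 0 := fun h => by simp [h] at hA
  have hpi : (Real.pi : ℂ) ≠ 0 := by exact_mod_cast Real.pi_ne_zero
  have hb : 0 < (Real.pi * A 2 τ / 2).re := by
    have : (Real.pi * A 2 τ / 2) = ((Real.pi / 2 : ℝ) : ℂ) * A 2 τ := by push_cast; ring
    rw [this, Complex.re_ofReal_mul]
    exact mul_pos (by positivity) hA
  induction n using Nat.twoStepInduction with
  | zero =>
    simp only [pow_zero, one_mul]
    rw [integral_gaussian_complex hb, moment_zero, one_mul]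
    have e : (Real.pi : ℂ) / (Real.pi * A 2 τ / 2) = ((2 : ℝ) : ℂ) * (A 2 τ)⁻¹ := by
      push_cast
      field_simp
    have hs : (Real.sqrt 2 : ℂ) = Complex.exp (Real.log 2 / 2) := by
      have : Real.sqrt 2 = Real.exp (Real.log 2 / 2) := by
        rw [Real.exp_half, Real.exp_log two_pos]
      rw [this]
      push_cast
      rfl
    have harg : (A 2 τ).arg ≠ Real.pi := by
      intro h
      rw [Complex.arg_eq_pi_iff] at h
      linarith [h.1]
    rw [e, Complex.cpow_def_of_ne_zero (by simp [hA0]), Complex.cpow_def_of_ne_zero hA0,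
      Complex.log_ofReal_mul two_pos (inv_ne_zero hA0), Complex.log_inv _ harg, hs,
      ← Complex.exp_sub]
    congr 1
    ring
  | one => rw [integral_ofReal_mul_cexp, moment_one, zero_mul]
  | more n ih _ =>
    rw [integral_pow_add_two_mul_cexp hb, ih, moment_add_two]
    ring

lemma integrable_polynomial_mul_cexp {b : ℂ} (hb : 0 < b.re) (p : Polynomial ℂ) :
    MeasureTheory.Integrable fun x : ℝ => p.eval (x : ℂ) * Complex.exp (-b * (x : ℂ) ^ 2) := by
  induction p using Polynomial.induction_on' with
  | add p q hp hq => simp only [Polynomial.eval_add, add_mul]; exact hp.add hq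
  | monomial n c =>
    simpa only [Polynomial.eval_monomial, mul_assoc] using
      (integrable_pow_mul_cexp_neg_mul_sq hb n).const_mul c

lemma re_gaussian_pos {τ : ℝ} (hA : 0 < (A 2 τ).re) : 0 < (Real.pi * A 2 τ / 2).re := by
  have : (Real.pi * A 2 τ / 2) = ((Real.pi / 2 : ℝ) : ℂ) * A 2 τ := by push_cast; ring
  rw [this, Complex.re_ofReal_mul]
  exact mul_pos (by positivity) hA

lemma integral_polynomial_mul_cexp {τ : ℝ} (hA : 0 < (A 2 τ).re) (p : Polynomial ℂ) :
    ∫ x : ℝ, p.eval (x : ℂ) * Complex.exp (-(Real.pi * A 2 τ / 2) * (x : ℂ) ^ 2) =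
      momentFunctional τ p * (Real.sqrt 2 / A 2 τ ^ (1 / 2 : ℂ)) := by
  have hb := re_gaussian_pos hA
  induction p using Polynomial.induction_on' with
  | add p q hp hq =>
    simp only [Polynomial.eval_add, add_mul, map_add]
    rw [MeasureTheory.integral_add (integrable_polynomial_mul_cexp hb p)
      (integrable_polynomial_mul_cexp hb q), hp, hq]
  | monomial n c =>
    rw [← Polynomial.C_mul_X_pow_eq_monomial, momentFunctional_C_mul_X_pow]
    simp only [Polynomial.eval_mul, Polynomial.eval_C, Polynomial.eval_pow, Polynomial.eval_X,
      mul_assoc]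
    rw [MeasureTheory.integral_const_mul, integral_pow_mul_cexp_eq_moment hA]

/-! ### Uniform bounds near the saddle -/

/-- Quantitative estimates at the main saddle, valid for all small `τ > 0`. -/
structure NearSaddle (τ : ℝ) : Prop where
  pos : 0 < τ
  Q_near : ‖Q₁ τ - 1‖ < 1
  T_near : ‖Q₁ τ + (τ : ℂ) ^ 2 - 1‖ < 1
  Q_inv : ‖(Q₁ τ)⁻¹‖ ≤ 51 / 50
  T_inv : ‖(Q₁ τ + (τ : ℂ) ^ 2)⁻¹‖ ≤ 51 / 50
  A_le : ∀ n, ‖A n τ‖ ≤ (21 / 20) ^ (n + 1)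
  B_le : ∀ n, ‖B n τ‖ ≤ 2 * (3 / 2) ^ n
  A_two_re : 19 / 20 ≤ (A 2 τ).re
  A_one : A 1 τ = 1

lemma tendsto_of_isPowerSeriesNearZero {h : ℝ → ℂ} {c : ℂ} (hh : IsPowerSeriesNearZero h c) :
    Tendsto h (𝓝[>] 0) (𝓝 c) := by
  obtain ⟨g, hg, hg0, hge⟩ := hh
  have hto : Tendsto (fun τ : ℝ => (τ : ℂ)) (𝓝[>] 0) (𝓝 0) := by
    simpa using (Complex.continuous_ofReal.tendsto 0).mono_left nhdsWithin_le_nhds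
  rw [← hg0]
  exact (hg.continuousAt.tendsto.comp hto).congr' (hge.mono fun _ h => h.symm)

lemma norm_A_le {τ : ℝ} (hQ : ‖(Q₁ τ)⁻¹‖ ≤ 51 / 50)
    (hT : ‖(Q₁ τ + (τ : ℂ) ^ 2)⁻¹‖ ≤ 51 / 50)
    (hk : ‖1 + (τ : ℂ) ^ 2 / (4 * Real.pi * Complex.I)‖ ≤ 101 / 100)
    (hw : ‖(τ : ℂ) ^ 4‖ ≤ 1 / 2000) (n : ℕ) : ‖A n τ‖ ≤ (21 / 20) ^ (n + 1) := by
  -- Bernoulli's inequality absorbs the factor `n` of the second term of `A_n` into a geometric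
  -- factor; `(51/50)² < 21/20` leaves room for it.
  have hn : (n : ℝ) ≤ 50 * (51 / 50) ^ n := by
    have := one_add_mul_le_pow (show (-2 : ℝ) ≤ 1 / 50 by norm_num) n
    norm_num at this ⊢
    linarith
  have h1 : ‖(1 + (τ : ℂ) ^ 2 / (4 * Real.pi * Complex.I)) / (Q₁ τ + (τ : ℂ) ^ 2) ^ n‖ ≤
      101 / 100 * (51 / 50) ^ n := by
    rw [div_eq_mul_inv, norm_mul, ← inv_pow, norm_pow]
    gcongr
  have h2 : ‖n * (τ : ℂ) ^ 4 / (4 * Q₁ τ ^ (n + 1))‖ ≤ 1 / 100 * (21 / 20) ^ n := by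
    have e : n * (τ : ℂ) ^ 4 / (4 * Q₁ τ ^ (n + 1)) =
        n * ((τ : ℂ) ^ 4 * (1 / 4)) * ((Q₁ τ)⁻¹) ^ (n + 1) := by
      rw [inv_pow, div_eq_mul_inv, mul_inv]; ring
    rw [e, norm_mul, norm_mul, norm_mul, norm_pow _ (n + 1), Complex.norm_natCast]
    have h4 : ‖(1 / 4 : ℂ)‖ = 1 / 4 := by norm_num
    rw [h4]
    calc (n : ℝ) * (‖(τ : ℂ) ^ 4‖ * (1 / 4)) * ‖(Q₁ τ)⁻¹‖ ^ (n + 1)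
        ≤ (50 * (51 / 50) ^ n) * (1 / 2000 * (1 / 4)) * (51 / 50) ^ (n + 1) := by gcongr
      _ = 51 / 8000 * ((51 / 50) ^ 2) ^ n := by
          rw [pow_succ, pow_right_comm, sq]; ring
      _ ≤ 1 / 100 * (21 / 20) ^ n := by
          have h5 : ((51 / 50 : ℝ) ^ 2) ^ n ≤ (21 / 20) ^ n :=
            pow_le_pow_left₀ (by norm_num) (by norm_num) n
          have h6 : (0 : ℝ) < (21 / 20) ^ n := by positivity
          linarith
  calc ‖A n τ‖ ≤ 101 / 100 * (51 / 50) ^ n + 1 / 100 * (21 / 20) ^ n :=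
        (norm_sub_le _ _).trans (add_le_add h1 h2)
    _ ≤ 101 / 100 * (21 / 20) ^ n + 1 / 100 * (21 / 20) ^ n := by
        have h5 : (51 / 50 : ℝ) ^ n ≤ (21 / 20) ^ n :=
          pow_le_pow_left₀ (by norm_num) (by norm_num) n
        linarith
    _ ≤ (21 / 20) ^ (n + 1) := by
        rw [pow_succ]
        have : (0 : ℝ) < (21 / 20) ^ n := by positivity
        linarith

lemma norm_B_le {τ : ℝ} (hQ0 : Q₁ τ ≠ 0) (hQ : ‖(Q₁ τ)⁻¹‖ ≤ 51 / 50) (hB : ‖B 0 τ‖ ≤ 2)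
    (n : ℕ) : ‖B n τ‖ ≤ 2 * (3 / 2) ^ n := by
  have e : B n τ = B 0 τ * ((Q₁ τ)⁻¹) ^ n := by
    rw [B, B, Nat.cast_zero, sub_zero, Complex.cpow_sub _ _ hQ0, Complex.cpow_natCast, inv_pow]
    rfl
  rw [e, norm_mul, norm_pow]
  have : ‖(Q₁ τ)⁻¹‖ ≤ 3 / 2 := hQ.trans (by norm_num)
  gcongr

lemma eventually_nearSaddle : ∀ᶠ τ : ℝ in 𝓝[>] 0, NearSaddle τ := by
  have hk : Tendsto (fun τ : ℝ => ‖1 + (τ : ℂ) ^ 2 / (4 * Real.pi * Complex.I)‖) (𝓝[>] 0)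
      (𝓝 1) := by
    simpa using ((tendsto_ofReal_sq.div_const (4 * Real.pi * Complex.I)).const_add 1).norm
  have hw : Tendsto (fun τ : ℝ => ‖(τ : ℂ) ^ 4‖) (𝓝[>] 0) (𝓝 0) := by
    have := (tendsto_ofReal_sq.pow 2).norm
    simpa [← pow_mul] using this
  have hA := (Complex.continuous_re.tendsto _).comp
    (tendsto_of_isPowerSeriesNearZero (A_isPowerSeriesNearZero 2))
  have hB := (tendsto_of_isPowerSeriesNearZero (B_isPowerSeriesNearZero 0)).norm
  simp only [norm_one] at hB
  filter_upwards [eventually_Q₁_near_one one_pos,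
    eventually_Q₁_near_one (show (0 : ℝ) < 1 / 50 by norm_num), self_mem_nhdsWithin,
    hk.eventually_le_const (show (1 : ℝ) < 101 / 100 by norm_num),
    hw.eventually_le_const (show (0 : ℝ) < 1 / 2000 by norm_num),
    hA.eventually_const_le (show (19 / 20 : ℝ) < (1 : ℂ).re by norm_num),
    hB.eventually_le_const (show (1 : ℝ) < 2 by norm_num), isMainSaddle_q₁]
    with τ h h' hτ hk hw hA hB hs
  have hQi : ‖(Q₁ τ)⁻¹‖ ≤ 51 / 50 := by linarith [h'.2.2.1]
  have hTi : ‖(Q₁ τ + (τ : ℂ) ^ 2)⁻¹‖ ≤ 51 / 50 := by linarith [h'.2.2.2]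
  have h1 := re_pos_of_near_one h.1
  have h2 := re_pos_of_near_one h.2.1
  have hQ0 : Q₁ τ ≠ 0 := fun h0 => by simp [h0] at h1
  have hT0 : Q₁ τ + (τ : ℂ) ^ 2 ≠ 0 := fun h0 => by simp [h0] at h2
  refine ⟨hτ, h.1, h.2.1, hQi, hTi, norm_A_le hQi hTi hk hw, norm_B_le hQ0 hQi hB, hA, ?_⟩
  -- `A₁ = 1` is the scaled saddle equation divided by `Q² (Q + w)`.
  have hP := hs.1
  rw [q₁_eq_Q₁ (Set.mem_Ioi.1 hτ).ne', isMainSaddle_scaled_iff hτ] at hP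
  have hrel := hP.1
  rw [A, div_four_pi_I, show (τ : ℂ) ^ 4 = ((τ : ℂ) ^ 2) ^ 2 by ring]
  set w := (τ : ℂ) ^ 2
  field_simp
  push_cast
  linear_combination -4 * hrel

namespace NearSaddle

variable {τ : ℝ} (h : NearSaddle τ)
include h

lemma Q_ne_zero : Q₁ τ ≠ 0 := fun h0 => by
  have := re_pos_of_near_one h.Q_near
  simp [h0] at this

lemma T_ne_zero : Q₁ τ + (τ : ℂ) ^ 2 ≠ 0 := fun h0 => by
  have := re_pos_of_near_one h.T_near
  simp [h0] at this

end NearSaddle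

/-! ### Exact expansion of phase and amplitude along the segment -/

/-- Additivity of the logarithm on the open right half plane. -/
lemma log_mul_of_re_pos {a b : ℂ} (ha : 0 < a.re) (hb : 0 < b.re) :
    Complex.log (a * b) = Complex.log a + Complex.log b := by
  have ha0 : a ≠ 0 := fun h0 => by simp [h0] at ha
  have hb0 : b ≠ 0 := fun h0 => by simp [h0] at hb
  have h1 := abs_lt.1 (Complex.abs_arg_lt_pi_div_two_iff.2 (Or.inl ha))
  have h2 := abs_lt.1 (Complex.abs_arg_lt_pi_div_two_iff.2 (Or.inl hb))
  exact (Complex.log_mul_eq_add_log_iff ha0 hb0).2 ⟨by linarith [h1.1, h2.1], by linarith [h1.2, h2.2]⟩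

lemma log_add_eq {a ζ : ℂ} (ha : 0 < a.re) (hζ : ‖ζ / a‖ < 1) :
    Complex.log (a + ζ) = Complex.log a + Complex.log (1 + ζ / a) := by
  have ha0 : a ≠ 0 := fun h0 => by simp [h0] at ha
  have h1 : 0 < (1 + ζ / a).re := re_pos_of_near_one (by simpa using hζ)
  rw [← log_mul_of_re_pos ha h1]
  congr 1
  field_simp

lemma hasSum_geometric_shift {a ζ : ℂ} (ha : a ≠ 0) (hζ : ‖ζ / a‖ < 1) :
    HasSum (fun n : ℕ => (-1) ^ n * ζ ^ n / a ^ (n + 1)) (1 / (a + ζ)) := by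
  have h := (hasSum_geometric_of_norm_lt_one (ξ := -(ζ / a)) (by rwa [norm_neg])).mul_left (1 / a)
  have h1 : 1 + ζ / a ≠ 0 := by
    intro h0
    have : ‖ζ / a‖ = 1 := by
      rw [show ζ / a = -1 by linear_combination h0]; simp
    linarith
  have e : 1 / (a + ζ) = 1 / a * (1 - -(ζ / a))⁻¹ := by
    have h2 : a + ζ = a * (1 + ζ / a) := by field_simp
    rw [h2, sub_neg_eq_add, one_div, mul_inv, one_div]
  rw [e]
  refine h.congr_fun fun n => ?_
  rw [neg_pow (ζ / a), div_pow, pow_succ]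
  field_simp

/-- The phase series at a fixed real `y`. -/
def phaseSeriesAt (τ y : ℝ) : PowerSeries ℂ :=
  PowerSeries.map (Polynomial.evalRingHom (y : ℂ)) (phaseSeries τ)

/-- The amplitude series at a fixed real `y`. -/
def ampSeriesAt (τ y : ℝ) : PowerSeries ℂ :=
  PowerSeries.map (Polynomial.evalRingHom (y : ℂ)) (ampSeries τ)

lemma coeff_phaseSeriesAt (τ y : ℝ) (j : ℕ) : PowerSeries.coeff j (phaseSeriesAt τ y) =
    phaseScalar τ j * (y : ℂ) ^ (j + 2) := by
  rw [phaseSeriesAt, PowerSeries.coeff_map, coeff_phaseSeries]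
  simp

lemma constantCoeff_phaseSeriesAt (τ y : ℝ) :
    PowerSeries.constantCoeff (phaseSeriesAt τ y) = 0 := by
  rw [← PowerSeries.coeff_zero_eq_constantCoeff_apply, coeff_phaseSeriesAt]
  simp [phaseScalar]

lemma coeff_ampSeriesAt_zero (τ y : ℝ) : PowerSeries.coeff 0 (ampSeriesAt τ y) = 1 := by
  rw [ampSeriesAt, PowerSeries.coeff_map, coeff_ampSeries_zero, map_one]

lemma coeff_ampSeriesAt_of_lt (τ y : ℝ) {j : ℕ} (h0 : j ≠ 0) (h5 : j < 5) :
    PowerSeries.coeff j (ampSeriesAt τ y) = 0 := by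
  rw [ampSeriesAt, PowerSeries.coeff_map, coeff_ampSeries_of_lt τ h0 h5, map_zero]

lemma coeff_ampSeriesAt_add_five (τ y : ℝ) (n : ℕ) :
    PowerSeries.coeff (n + 5) (ampSeriesAt τ y) =
      eps ^ 3 / 4 * Ring.choose (-(5 / 2) : ℂ) n * B n τ / eps ^ n * (y : ℂ) ^ n := by
  rw [ampSeriesAt, PowerSeries.coeff_map]
  simp [ampSeries]

lemma eval_expansionCoeff (τ y : ℝ) (m : ℕ) : (expansionCoeff τ m).eval (y : ℂ) =
    mulExpCoeff (ampSeriesAt τ y) (phaseSeriesAt τ y) m := by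
  rw [mulExpCoeff, expansionCoeff, ← Polynomial.coe_evalRingHom, ← PowerSeries.coeff_map, map_mul,
    map_sum]
  congr 2
  refine Finset.sum_congr rfl fun k _ => ?_
  rw [map_mul, map_pow, PowerSeries.map_C]
  simp [phaseSeriesAt]

/-- The displacement from the scaled saddle in the direction of the segment. -/
def disp (x : ℝ) : ℂ := -eps ^ 3 * x

lemma norm_disp (x : ℝ) : ‖disp x‖ = |x| := by
  simp [disp, norm_eps]

lemma I_mul_disp (x : ℝ) : Complex.I * disp x = eps * x := by
  rw [disp, ← eps_sq]
  linear_combination (-(eps * x)) * eps_pow_four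

lemma disp_eq (x : ℝ) : disp x = x / eps := by
  rw [eq_div_iff eps_ne_zero, disp]
  linear_combination (-(x : ℂ)) * eps_pow_four

lemma segment_point {τ : ℝ} (hτ : τ ≠ 0) (x : ℝ) : q₁ τ + eps * x / (τ : ℂ) ^ 2 =
    Complex.I * (Q₁ τ + disp x) / (τ : ℂ) ^ 2 := by
  rw [q₁_eq_Q₁ hτ, mul_add, I_mul_disp]
  ring

namespace NearSaddle

variable {τ : ℝ} (h : NearSaddle τ)
include h

lemma norm_disp_div_Q {x : ℝ} (hx : |x| ≤ 1 / 2) : ‖disp x / Q₁ τ‖ < 1 := by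
  rw [div_eq_mul_inv, norm_mul, norm_disp]
  have := mul_le_mul hx h.Q_inv (norm_nonneg _) (by norm_num)
  linarith

lemma norm_disp_div_T {x : ℝ} (hx : |x| ≤ 1 / 2) : ‖disp x / (Q₁ τ + (τ : ℂ) ^ 2)‖ < 1 := by
  rw [div_eq_mul_inv, norm_mul, norm_disp]
  have := mul_le_mul hx h.T_inv (norm_nonneg _) (by norm_num)
  linarith

lemma Q_add_disp_ne_zero {x : ℝ} (hx : |x| ≤ 1 / 2) : Q₁ τ + disp x ≠ 0 := by
  intro h0
  have h1 := h.norm_disp_div_Q hx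
  rw [show disp x = -Q₁ τ by linear_combination h0, neg_div, div_self h.Q_ne_zero] at h1
  simp at h1

lemma T_add_disp_ne_zero {x : ℝ} (hx : |x| ≤ 1 / 2) : Q₁ τ + (τ : ℂ) ^ 2 + disp x ≠ 0 := by
  intro h0
  have h1 := h.norm_disp_div_T hx
  rw [show disp x = -(Q₁ τ + (τ : ℂ) ^ 2) by linear_combination h0, neg_div,
    div_self h.T_ne_zero] at h1
  simp at h1

lemma log_one_sub_I_mul {x : ℝ} (hx : |x| ≤ 1 / 2) :
    Complex.log (1 - Complex.I * (Complex.I * (Q₁ τ + disp x) / (τ : ℂ) ^ 2)) =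
      Complex.log (Q₁ τ + (τ : ℂ) ^ 2)
        + Complex.log (1 + disp x / (Q₁ τ + (τ : ℂ) ^ 2)) - 2 * (Real.log τ : ℂ) := by
  have hτ0 := h.pos
  have hτ' : (τ : ℂ) ≠ 0 := by exact_mod_cast hτ0.ne'
  have : 1 - Complex.I * (Complex.I * (Q₁ τ + disp x) / (τ : ℂ) ^ 2)
      = (((τ ^ 2)⁻¹ : ℝ) : ℂ) * (Q₁ τ + (τ : ℂ) ^ 2 + disp x) := by
    push_cast
    field_simp
    simp
    ring
  rw [this, Complex.log_ofReal_mul (by positivity) (h.T_add_disp_ne_zero hx), Real.log_inv,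
    Real.log_pow, log_add_eq (re_pos_of_near_one h.T_near) (h.norm_disp_div_T hx)]
  push_cast
  ring

lemma phase_sub_phase {x : ℝ} (hx : |x| ≤ 1 / 2) :
    phase τ (q₁ τ + eps * x / (τ : ℂ) ^ 2) - phase τ (q₁ τ) =
      logWeight τ * Complex.log (1 + disp x / (Q₁ τ + (τ : ℂ) ^ 2))
      + Real.pi * Complex.I * (τ : ℂ) ^ 2 / 4 * (1 / (Q₁ τ + disp x) - 1 / Q₁ τ)
      - Real.pi * Complex.I / (τ : ℂ) ^ 2 * disp x := by
  have hτ' : (τ : ℂ) ≠ 0 := by exact_mod_cast h.pos.ne'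
  have h0 : q₁ τ = Complex.I * (Q₁ τ + disp 0) / (τ : ℂ) ^ 2 := by
    rw [← segment_point h.pos.ne']; simp
  have hl := h.log_one_sub_I_mul hx
  have hl0 := h.log_one_sub_I_mul (x := 0) (by norm_num)
  rw [segment_point h.pos.ne' x, h0, phase, phase, hl, hl0, logWeight]
  have hd : disp 0 = 0 := by simp [disp]
  simp only [hd, add_zero, zero_div, Complex.log_one]
  have hQ := h.Q_ne_zero
  have hQd := h.Q_add_disp_ne_zero hx
  have hi : ∀ X : ℂ, X ≠ 0 → (Real.pi : ℂ) / (4 * (Complex.I * X / (τ : ℂ) ^ 2)) =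
      -(Real.pi * Complex.I * (τ : ℂ) ^ 2 / 4 * (1 / X)) := by
    intro X hX
    have := Complex.I_ne_zero
    field_simp
    simp
  rw [hi _ hQ, hi _ hQd]
  ring

/-- The logarithmic series in `disp x / (Q₁ + τ²)` and the geometric series in `disp x / Q₁`
contribute the two terms of `A_n`. Both converge since `|x| ≤ 1/2` and `Q₁`, `Q₁ + τ²` are close to
`1`. -/
lemma hasSum_phase {x : ℝ} (hx : |x| ≤ 1 / 2) :
    HasSum (fun n : ℕ => Real.pi * Complex.I / (τ : ℂ) ^ 2 * (-1) ^ (n + 1) * A n τ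
        * disp x ^ n / n)
      (phase τ (q₁ τ + eps * x / (τ : ℂ) ^ 2) - phase τ (q₁ τ)
        + Real.pi * Complex.I / (τ : ℂ) ^ 2 * disp x) := by
  have hτ' : (τ : ℂ) ≠ 0 := by exact_mod_cast h.pos.ne'
  have hpi : (Real.pi : ℂ) ≠ 0 := by exact_mod_cast Real.pi_ne_zero
  have h1 := (Complex.hasSum_taylorSeries_log (h.norm_disp_div_T hx)).mul_left (logWeight τ)
  have h2 := ((hasSum_geometric_shift h.Q_ne_zero (h.norm_disp_div_Q hx)).sub
    (hasSum_ite_eq 0 (1 / Q₁ τ))).mul_left (Real.pi * Complex.I * (τ : ℂ) ^ 2 / 4)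
  rw [h.phase_sub_phase hx, sub_add_cancel]
  refine (h1.add h2).congr_fun fun n => ?_
  rcases n with _ | n
  · simp
  · have hT := h.T_ne_zero
    have hQ := h.Q_ne_zero
    have hn : ((n : ℂ) + 1) ≠ 0 := by exact_mod_cast n.succ_ne_zero
    have e1 : logWeight τ = Real.pi * Complex.I / (τ : ℂ) ^ 2
        * (1 + (τ : ℂ) ^ 2 / (4 * Real.pi * Complex.I)) := by
      rw [logWeight]
      have := Complex.I_ne_zero
      field_simp
      ring
    rw [e1, A]
    simp only [n.succ_ne_zero, if_false, sub_zero, div_pow]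
    push_cast
    set L := 1 + (τ : ℂ) ^ 2 / (4 * Real.pi * Complex.I)
    set T := Q₁ τ + (τ : ℂ) ^ 2
    set Q := Q₁ τ
    field_simp
    ring

lemma phase_eq_series {y : ℝ} (hy : |τ * y| ≤ 1 / 2) :
    phase τ (q₁ τ + eps * ((τ * y : ℝ) : ℂ) / (τ : ℂ) ^ 2) - phase τ (q₁ τ) =
      -(Real.pi * A 2 τ / 2) * (y : ℂ) ^ 2 + seriesValue (phaseSeriesAt τ y) τ := by
  have hτ' : (τ : ℂ) ≠ 0 := by exact_mod_cast h.pos.ne'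
  have hf := h.hasSum_phase hy
  set f : ℕ → ℂ := fun n : ℕ => Real.pi * Complex.I / (τ : ℂ) ^ 2 * (-1) ^ (n + 1) * A n τ
        * disp (τ * y) ^ n / n with hfdef
  have f0 : f 0 = 0 := by simp [hfdef]
  have f1 : f 1 = Real.pi * Complex.I / (τ : ℂ) ^ 2 * disp (τ * y) := by
    simp [hfdef, h.A_one]
  -- Here the direction matters: `(x / ε)² = -i x²` turns the quadratic term into a Gaussian with
  -- real part of `A₂` close to `1`.
  have f2 : f 2 = -(Real.pi * A 2 τ / 2) * (y : ℂ) ^ 2 := by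
    have : disp (τ * y) ^ 2 = -Complex.I * ((τ : ℂ) * y) ^ 2 := by
      rw [disp, show (-eps ^ 3 * ((τ * y : ℝ) : ℂ)) ^ 2
        = eps ^ 4 * eps ^ 2 * ((τ * y : ℝ) : ℂ) ^ 2 by ring, eps_pow_four, eps_sq]
      push_cast
      ring
    simp only [hfdef, this]
    field_simp
    push_cast
    linear_combination (2 * A 2 τ * (y : ℂ) ^ 2) * Complex.I_sq
  have hs := (hasSum_nat_add_iff' 2).2 hf
  simp only [Finset.sum_range_succ, Finset.sum_range_zero, f0, f1, zero_add,
    add_sub_cancel_right] at hs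
  -- After the shift by two, index `0` is the quadratic term; it is removed because `phaseSeries`
  -- has no constant term.
  have hs2 := hs.sub (hasSum_ite_eq 0 (f 2))
  have hv : seriesValue (phaseSeriesAt τ y) τ =
      phase τ (q₁ τ + eps * ((τ * y : ℝ) : ℂ) / (τ : ℂ) ^ 2) - phase τ (q₁ τ) - f 2 := by
    refine HasSum.tsum_eq (hs2.congr_fun fun j => ?_)
    rw [coeff_phaseSeriesAt, phaseScalar]
    rcases j with _ | j
    · simp
    · simp only [j.succ_ne_zero, if_false, sub_zero, hfdef, disp]
      push_cast
      have hj : ((j : ℂ) + 1 + 2) ≠ 0 := by exact_mod_cast (j + 2).succ_ne_zero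
      have e : (-1 : ℂ) ^ (j + 1 + 2 + 1) * (-eps ^ 3 * (τ * y)) ^ (j + 1 + 2) =
          -(eps ^ (3 * (j + 1 + 2)) * ((τ : ℂ) * y) ^ (j + 1 + 2)) := by
        rw [pow_succ, mul_comm ((-1 : ℂ) ^ (j + 1 + 2)), mul_assoc, ← mul_pow, pow_mul,
          ← mul_pow]
        ring
      have e2 : ((τ : ℂ) * y) ^ (j + 1 + 2) = τ ^ (j + 1) * τ ^ 2 * y ^ (j + 1 + 2) := by
        rw [mul_pow, pow_add]
      calc _ = -(Real.pi * Complex.I) * A (j + 1 + 2) τ * eps ^ (3 * (j + 1 + 2))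
            / (j + 1 + 2) * (τ ^ (j + 1) * y ^ (j + 1 + 2)) := by ring
        _ = Real.pi * Complex.I / (τ : ℂ) ^ 2 * A (j + 1 + 2) τ / (j + 1 + 2) *
            -(eps ^ (3 * (j + 1 + 2)) * (τ ^ (j + 1) * τ ^ 2 * y ^ (j + 1 + 2))) := by
            field_simp
        _ = _ := by rw [← e2, ← e]; ring
  rw [hv, f2]
  ring

/-- A geometric series of ratio `(21/20) (1/2) = 21/40`, with `1 / n ≤ 1/3` for `n ≥ 3`. The total
`(21/20)³ (21/40) / (3 (1 - 21/40)) ≈ 0.4265` is below `43/100`, hence below the Gaussian rate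
`19/40`. -/
lemma weightedBound_phaseSeriesAt {y r : ℝ} (hr : 0 ≤ r) (hyr : |y| * r ≤ 1 / 2) :
    WeightedBound (phaseSeriesAt τ y) r (Real.pi * (43 / 100) * y ^ 2) := by
  have hq : (0 : ℝ) ≤ 21 / 40 := by norm_num
  have hgeo := (hasSum_geometric_of_lt_one hq (by norm_num)).mul_left
    (Real.pi * ((21 / 20) ^ 3 * (21 / 40) / 3) * y ^ 2)
  have hg2 : HasSum (fun j : ℕ => if j = 0 then 0 else
      Real.pi * ((21 / 20) ^ 3 * (21 / 40) / 3) * y ^ 2 * (21 / 40) ^ (j - 1))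
      (Real.pi * ((21 / 20) ^ 3 * (21 / 40) / 3) * y ^ 2 * (1 - 21 / 40)⁻¹) := by
    rw [← hasSum_nat_add_iff' 1]
    simpa using hgeo
  have hle : ∀ j, ‖PowerSeries.coeff j (phaseSeriesAt τ y)‖ * r ^ j ≤ if j = 0 then 0 else
      Real.pi * ((21 / 20) ^ 3 * (21 / 40) / 3) * y ^ 2 * (21 / 40) ^ (j - 1) := by
    intro j
    rw [coeff_phaseSeriesAt, phaseScalar]
    rcases j with _ | j
    · simp
    · simp only [j.succ_ne_zero, if_false, Nat.add_sub_cancel]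
      have hn : ‖((j + 1 : ℕ) : ℂ) + 2‖ = (j : ℝ) + 3 := by
        have : ((j + 1 : ℕ) : ℂ) + 2 = ((j + 3 : ℕ) : ℂ) := by push_cast; ring
        rw [this, Complex.norm_natCast]
        push_cast
        ring
      rw [norm_mul, norm_div, norm_mul, norm_mul, norm_neg, norm_mul, norm_pow, norm_pow, norm_eps,
        one_pow, hn, Complex.norm_I, Complex.norm_real, Complex.norm_real,
        Real.norm_of_nonneg Real.pi_pos.le, Real.norm_eq_abs, mul_one, mul_one]
      have hA := h.A_le (j + 1 + 2)
      have hj : (3 : ℝ) ≤ j + 3 := by linarith [j.cast_nonneg (α := ℝ)]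
      calc Real.pi * ‖A (j + 1 + 2) τ‖ / (j + 3) * |y| ^ (j + 1 + 2) * r ^ (j + 1)
          = Real.pi * ‖A (j + 1 + 2) τ‖ / (j + 3) * y ^ 2 * (|y| * r) ^ (j + 1) := by
            rw [mul_pow, pow_add |y| (j + 1) 2, sq_abs]; ring
        _ ≤ Real.pi * (21 / 20) ^ (j + 1 + 2 + 1) / 3 * y ^ 2 * (1 / 2) ^ (j + 1) := by
            gcongr
        _ = _ := by
            rw [show (21 / 40 : ℝ) ^ j = (21 / 20) ^ j * (1 / 2) ^ j by
              rw [← mul_pow]; norm_num]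
            ring
  have hs : Summable fun j => ‖PowerSeries.coeff j (phaseSeriesAt τ y)‖ * r ^ j :=
    Summable.of_nonneg_of_le (fun n => by positivity) hle hg2.summable
  refine ⟨hs, (hasSum_le hle hs.hasSum hg2).trans ?_⟩
  have : 0 ≤ Real.pi * y ^ 2 := by positivity
  norm_num
  nlinarith

end NearSaddle

/-- A majorant for the amplitude series. -/
def ampMajorant : ℝ := 1 + 1 / 2 * ∑' n, ‖Ring.choose (-(5 / 2) : ℂ) n‖ * (3 / 4) ^ n

lemma summable_choose : Summable fun n => ‖Ring.choose (-(5 / 2) : ℂ) n‖ * (3 / 4 : ℝ) ^ n := by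
  have h1 : ((3 / 4 : NNReal) : ENNReal) < (binomialSeries ℂ (-(5 / 2) : ℂ)).radius := by
    refine lt_of_lt_of_le ?_ binomialSeries_radius_ge_one
    rw [ENNReal.coe_lt_one_iff, ← NNReal.coe_lt_coe]
    norm_num
  have h2 := (binomialSeries ℂ (-(5 / 2) : ℂ)).summable_norm_mul_pow h1
  simpa [binomialSeries, FormalMultilinearSeries.ofScalars_norm] using h2

lemma hasSum_choose {z : ℂ} (hz : ‖z‖ < 1) :
    HasSum (fun n => Ring.choose (-(5 / 2) : ℂ) n * z ^ n) ((1 + z) ^ (-(5 / 2) : ℂ)) := by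
  have h := (Complex.one_add_cpow_hasFPowerSeriesOnBall_zero (a := -(5 / 2))).hasSum (y := z)
    (by simpa [← ENNReal.ofReal_one, Metric.eball_ofReal] using hz)
  rw [zero_add] at h
  refine h.congr_fun fun n => ?_
  rw [binomialSeries_apply]
  simp

namespace NearSaddle

variable {τ : ℝ} (h : NearSaddle τ)
include h

lemma weightedBound_ampSeriesAt {y r : ℝ} (hr : 0 ≤ r) (hr1 : r ≤ 1) (hyr : |y| * r ≤ 1 / 2) :
    WeightedBound (ampSeriesAt τ y) r ampMajorant := by
  have hle : ∀ n, ‖PowerSeries.coeff (n + 5) (ampSeriesAt τ y)‖ * r ^ (n + 5) ≤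
      1 / 2 * (‖Ring.choose (-(5 / 2) : ℂ) n‖ * (3 / 4) ^ n) := by
    intro n
    rw [coeff_ampSeriesAt_add_five, norm_mul, norm_div, norm_mul, norm_mul, norm_div, norm_pow,
      norm_pow, norm_pow, norm_eps, one_pow, one_pow, Complex.norm_real, Complex.norm_ofNat,
      Real.norm_eq_abs, div_one]
    have hB := h.B_le n
    calc 1 / 4 * ‖Ring.choose (-(5 / 2) : ℂ) n‖ * ‖B n τ‖ * |y| ^ n * r ^ (n + 5)
        = 1 / 4 * ‖Ring.choose (-(5 / 2) : ℂ) n‖ * ‖B n τ‖ * (|y| * r) ^ n * r ^ 5 := by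
          rw [mul_pow, pow_add]; ring
      -- The growth `(3/2)^n` allowed for `B_n`, halved by `|y| r ≤ 1/2`, gives the ratio `3/4`,
      -- inside the unit disc of convergence of the binomial series.
      _ ≤ 1 / 4 * ‖Ring.choose (-(5 / 2) : ℂ) n‖ * (2 * (3 / 2) ^ n) * (1 / 2) ^ n * 1 ^ 5 := by
          gcongr
      _ = _ := by
          rw [show (3 / 4 : ℝ) ^ n = (3 / 2) ^ n * (1 / 2) ^ n by rw [← mul_pow]; norm_num]
          ring
  have hm := summable_choose.mul_left (1 / 2)
  have hs5 : Summable fun n => ‖PowerSeries.coeff (n + 5) (ampSeriesAt τ y)‖ * r ^ (n + 5) :=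
    Summable.of_nonneg_of_le (fun n => by positivity) hle hm
  have hs := (summable_nat_add_iff (f := fun n =>
    ‖PowerSeries.coeff n (ampSeriesAt τ y)‖ * r ^ n) 5).1 hs5
  refine ⟨hs, ?_⟩
  rw [← hs.sum_add_tsum_nat_add 5, ampMajorant, ← tsum_mul_left]
  refine add_le_add ?_ (hs5.tsum_le_tsum hle hm)
  simp [Finset.sum_range_succ, coeff_ampSeriesAt_zero, coeff_ampSeriesAt_of_lt,
    -PowerSeries.coeff_zero_eq_constantCoeff]

lemma amp_eq_series {y : ℝ} (hy : |τ * y| ≤ 1 / 2) (hτ1 : τ ≤ 1) :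
    amp (q₁ τ + eps * ((τ * y : ℝ) : ℂ) / (τ : ℂ) ^ 2) = seriesValue (ampSeriesAt τ y) τ := by
  have hτ' : (τ : ℂ) ≠ 0 := by exact_mod_cast h.pos.ne'
  have hyr : |y| * τ ≤ 1 / 2 := by
    rwa [abs_mul, abs_of_pos h.pos, mul_comm] at hy
  have hsn := (h.weightedBound_ampSeriesAt h.pos.le hτ1 hyr).summable_norm (u := τ)
    (by rw [Complex.norm_real, Real.norm_of_nonneg h.pos.le])
  rw [seriesValue, ← hsn.of_norm.sum_add_tsum_nat_add 5]
  have e1 : ∑ i ∈ Finset.range 5, PowerSeries.coeff i (ampSeriesAt τ y) * (τ : ℂ) ^ i = 1 := by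
    simp [Finset.sum_range_succ, coeff_ampSeriesAt_zero, coeff_ampSeriesAt_of_lt,
      -PowerSeries.coeff_zero_eq_constantCoeff]
  have hQ := h.Q_ne_zero
  have hz := h.norm_disp_div_Q hy
  have e2 : ∑' n, PowerSeries.coeff (n + 5) (ampSeriesAt τ y) * (τ : ℂ) ^ (n + 5) =
      eps ^ 3 / 4 * τ ^ 5 * Q₁ τ ^ (-(5 / 2) : ℂ) *
        (1 + disp (τ * y) / Q₁ τ) ^ (-(5 / 2) : ℂ) := by
    refine HasSum.tsum_eq (((hasSum_choose hz).mul_left _).congr_fun fun n => ?_)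
    rw [coeff_ampSeriesAt_add_five, B, Complex.cpow_sub _ _ hQ, Complex.cpow_natCast, disp_eq]
    have := eps_ne_zero
    push_cast
    rw [div_pow, div_pow, mul_pow, pow_add]
    field_simp
  rw [e1, e2, segment_point h.pos.ne', amp, logCut]
  have e3 : -Complex.I * (Complex.I * (Q₁ τ + disp (τ * y)) / (τ : ℂ) ^ 2) =
      (((τ ^ 2)⁻¹ : ℝ) : ℂ) * (Q₁ τ + disp (τ * y)) := by
    push_cast
    field_simp
    simp
  have hz1 : 1 + disp (τ * y) / Q₁ τ ≠ 0 := by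
    intro h0
    apply h.Q_add_disp_ne_zero hy
    have : Q₁ τ + disp (τ * y) = Q₁ τ * (1 + disp (τ * y) / Q₁ τ) := by field_simp
    rw [this, h0, mul_zero]
  have hpos := h.pos
  rw [e3, Complex.log_ofReal_mul (by positivity) (h.Q_add_disp_ne_zero hy), Real.log_inv,
    Real.log_pow, log_add_eq (re_pos_of_near_one h.Q_near) hz,
    Complex.cpow_def_of_ne_zero hQ, Complex.cpow_def_of_ne_zero hz1]
  have hτ5 : (τ : ℂ) ^ 5 = Complex.exp (5 * Real.log τ) := by
    rw [show (5 : ℂ) * (Real.log τ : ℂ) = ((5 : ℕ) : ℂ) * (Real.log τ : ℂ) by norm_num,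
      Complex.exp_nat_mul, ← Complex.ofReal_exp, Real.exp_log h.pos]
  -- The chosen branch gives `i^(-5/2) = exp (-5 π i / 4)`, which is `ε³` because `ε⁸ = 1`.
  have he3 : eps ^ 3 = Complex.exp (-(5 / 2) * (Real.pi * Complex.I / 2)) := by
    have h8 : eps ^ 3 * eps ^ 5 = 1 := by
      rw [show eps ^ 3 * eps ^ 5 = (eps ^ 4) ^ 2 by ring, eps_pow_four]; norm_num
    have h5 : eps ^ 5 = Complex.exp (5 / 2 * (Real.pi * Complex.I / 2)) := by
      rw [eps, ← Complex.exp_nat_mul]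
      congr 1
      push_cast
      ring
    rw [neg_mul, Complex.exp_neg, ← h5]
    exact eq_inv_of_mul_eq_one_left h8
  rw [hτ5, he3]
  have hfin : ∀ a b c d e : ℂ, e = a + b + c + d → 1 + 1 / 4 * Complex.exp e =
      1 + Complex.exp a / 4 * Complex.exp b * Complex.exp c * Complex.exp d := by
    rintro a b c d e rfl
    rw [Complex.exp_add, Complex.exp_add, Complex.exp_add]
    ring
  apply hfin
  push_cast
  ring

end NearSaddle

/-! ### Reduction to the Gaussian integral and error estimate -/

/-- The integrand of `J₄` relative to its value at the saddle, in the variable `y`, extended by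
zero outside the segment. -/
def localIntegrand (τ : ℝ) : ℝ → ℂ :=
  (Set.Ioc (-(1 / (2 * τ))) (1 / (2 * τ))).indicator fun y =>
    amp (q₁ τ + eps * ((τ * y : ℝ) : ℂ) / (τ : ℂ) ^ 2)
      * Complex.exp (phase τ (q₁ τ + eps * ((τ * y : ℝ) : ℂ) / (τ : ℂ) ^ 2) - phase τ (q₁ τ))

/-- The Gaussian approximation of `localIntegrand` to order `N`. -/
def gaussianApprox (τ : ℝ) (N : ℕ) (y : ℝ) : ℂ :=
  (∑ m ∈ Finset.range N, (expansionCoeff τ m).eval (y : ℂ) * (τ : ℂ) ^ m)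
    * Complex.exp (-(Real.pi * A 2 τ / 2) * (y : ℂ) ^ 2)

/-- The common factor of `J₄` and `prefactor`. -/
def saddleFactor (τ : ℝ) : ℂ :=
  2 * Real.pi * eps / τ * Complex.exp (phase τ (q₁ τ))

lemma J₄_eq {τ : ℝ} (hτ : 0 < τ) : J₄ τ = saddleFactor τ * ∫ y, localIntegrand τ y := by
  have hτ' : (τ : ℂ) ≠ 0 := by exact_mod_cast hτ.ne'
  have hL : -(1 / (2 * τ)) ≤ 1 / (2 * τ) := by
    have : 0 < 1 / (2 * τ) := by positivity
    linarith
  rw [localIntegrand, MeasureTheory.integral_indicator measurableSet_Ioc,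
    ← intervalIntegral.integral_of_le hL, J₄, segmentIntegral, saddleFactor]
  set F : ℝ → ℂ := fun s => amp (q₁Minus τ + (s : ℂ) * (q₁Plus τ - q₁Minus τ)) *
    Complex.exp (phase τ (q₁Minus τ + (s : ℂ) * (q₁Plus τ - q₁Minus τ)))
    * (q₁Plus τ - q₁Minus τ) with hF
  -- Substitution `s = τ y + 1/2`: the saddle is the midpoint of the segment.
  have h1 := intervalIntegral.smul_integral_comp_mul_add (a := -(1 / (2 * τ)))
    (b := 1 / (2 * τ)) F τ (1 / 2)
  have ea : τ * -(1 / (2 * τ)) + 1 / 2 = 0 := by field_simp; ring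
  have eb : τ * (1 / (2 * τ)) + 1 / 2 = 1 := by field_simp; norm_num
  rw [ea, eb] at h1
  rw [← h1, ← intervalIntegral.integral_const_mul, Complex.real_smul,
    ← intervalIntegral.integral_const_mul, ← intervalIntegral.integral_const_mul]
  refine intervalIntegral.integral_congr fun y _ => ?_
  have ez : q₁Minus τ + ((τ * y + 1 / 2 : ℝ) : ℂ) * (q₁Plus τ - q₁Minus τ) =
      q₁ τ + eps * ((τ * y : ℝ) : ℂ) / (τ : ℂ) ^ 2 := by
    rw [q₁Minus, q₁Plus]
    push_cast
    ring
  have ed : q₁Plus τ - q₁Minus τ = eps / (τ : ℂ) ^ 2 := by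
    rw [q₁Minus, q₁Plus]
    ring
  simp only [hF]
  rw [ez, ed, Complex.exp_sub]
  have := Complex.exp_ne_zero (phase τ (q₁ τ))
  field_simp

lemma prefactor_eq {τ : ℝ} (hτ : 0 < τ) :
    prefactor τ = saddleFactor τ * (Real.sqrt 2 / A 2 τ ^ (1 / 2 : ℂ)) := by
  have hτ' : (τ : ℂ) ≠ 0 := by exact_mod_cast hτ.ne'
  have h1 : ((τ ^ (-(3 / 2) : ℝ) : ℝ) : ℂ) * (Real.sqrt τ : ℂ) = 1 / τ := by
    rw [← Complex.ofReal_mul, Real.sqrt_eq_rpow, ← Real.rpow_add hτ]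
    norm_num [Real.rpow_neg_one]
  have h2 : Complex.exp
        (Complex.I * ((-2 * Real.pi * Real.log τ - Real.pi) / (τ : ℂ) ^ 2 + Real.pi / 4)) *
      Complex.exp (-(Complex.I * ((-2 * Real.pi * Real.log τ - Real.pi) / (τ : ℂ) ^ 2))) = eps := by
    rw [← Complex.exp_add, eps]
    congr 1
    ring
  rw [prefactor, E, saddleFactor]
  calc _ = 2 * Real.pi * (Complex.exp
        (Complex.I * ((-2 * Real.pi * Real.log τ - Real.pi) / (τ : ℂ) ^ 2 + Real.pi / 4)) *
      Complex.exp (-(Complex.I * ((-2 * Real.pi * Real.log τ - Real.pi) / (τ : ℂ) ^ 2))))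
        * (((τ ^ (-(3 / 2) : ℝ) : ℝ) : ℂ) * (Real.sqrt τ : ℂ))
        * Complex.exp (phase τ (q₁ τ)) * (Real.sqrt 2 / A 2 τ ^ (1 / 2 : ℂ)) := by ring
    _ = _ := by rw [h1, h2]; ring

lemma norm_saddleFactor {τ : ℝ} (hτ : 0 < τ) :
    ‖saddleFactor τ‖ = 2 * Real.pi * τ ^ (-(3 / 2) : ℝ) * ‖E τ‖ := by
  have h1 : τ ^ (-(3 / 2) : ℝ) * Real.sqrt τ = τ⁻¹ := by
    rw [Real.sqrt_eq_rpow, ← Real.rpow_add hτ]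
    norm_num [Real.rpow_neg_one]
  have hE : ‖Complex.exp (-(Complex.I *
      ((-2 * Real.pi * Real.log τ - Real.pi) / (τ : ℂ) ^ 2)))‖ = 1 := by
    have : -(Complex.I * ((-2 * Real.pi * Real.log τ - Real.pi) / (τ : ℂ) ^ 2)) =
        ((-((-2 * Real.pi * Real.log τ - Real.pi) / τ ^ 2) : ℝ) : ℂ) * Complex.I := by
      push_cast; ring
    rw [this, Complex.norm_exp_ofReal_mul_I]
  rw [saddleFactor, E, norm_mul, norm_mul, norm_mul, hE, norm_neg, norm_div, norm_mul, norm_mul,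
    norm_eps, Complex.norm_real, Complex.norm_real, Complex.norm_real, Complex.norm_ofNat,
    Real.norm_of_nonneg Real.pi_pos.le, Real.norm_of_nonneg hτ.le,
    Real.norm_of_nonneg (Real.sqrt_nonneg τ), div_eq_mul_inv, ← h1]
  ring

lemma integrable_one_add_abs_pow_mul_exp {c : ℝ} (hc : 0 < c) (N : ℕ) :
    MeasureTheory.Integrable fun y : ℝ => (1 + |y|) ^ N * Real.exp (-c * y ^ 2) := by
  have h : ∀ y : ℝ, (1 + |y|) ^ N * Real.exp (-c * y ^ 2) =
      ∑ i ∈ Finset.range (N + 1), (N.choose i : ℝ) * ‖y ^ i * Real.exp (-c * y ^ 2)‖ := by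
    intro y
    rw [add_comm, add_pow, Finset.sum_mul]
    refine Finset.sum_congr rfl fun i _ => ?_
    rw [norm_mul, norm_pow, Real.norm_eq_abs, Real.norm_of_nonneg (Real.exp_pos _).le]
    ring
  simp_rw [h]
  exact MeasureTheory.integrable_finsetSum _ fun i _ =>
    (integrable_pow_mul_exp_neg_mul_sq hc i).norm.const_mul _

lemma measurable_localIntegrand (τ : ℝ) : Measurable (localIntegrand τ) := by
  refine Measurable.indicator ?_ measurableSet_Ioc
  unfold amp logCut phase
  fun_prop

lemma ampMajorant_nonneg : 0 ≤ ampMajorant := by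
  unfold ampMajorant
  have : 0 ≤ ∑' n, ‖Ring.choose (-(5 / 2) : ℂ) n‖ * (3 / 4 : ℝ) ^ n :=
    tsum_nonneg fun n => by positivity
  positivity

lemma gaussianApprox_eq (τ : ℝ) (N : ℕ) (y : ℝ) : gaussianApprox τ N y =
    (∑ m ∈ Finset.range N, expansionCoeff τ m * Polynomial.C ((τ : ℂ) ^ m)).eval (y : ℂ)
      * Complex.exp (-(Real.pi * A 2 τ / 2) * (y : ℂ) ^ 2) := by
  rw [gaussianApprox, Polynomial.eval_finsetSum]
  simp only [Polynomial.eval_mul, Polynomial.eval_C]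

namespace NearSaddle

variable {τ : ℝ} (h : NearSaddle τ)
include h

/-- The decay rate left over is `(1/2) (19/20) - 43/100 = 9/200`, in units of `π`. -/
lemma gaussian_decay (y : ℝ) {M : ℝ} (hM : 0 ≤ M) :
    M * Real.exp (Real.pi * (43 / 100) * y ^ 2)
      * ‖Complex.exp (-(Real.pi * A 2 τ / 2) * (y : ℂ) ^ 2)‖
      ≤ M * Real.exp (-(Real.pi * (9 / 200)) * y ^ 2) := by
  rw [norm_cexp_neg_mul_sq, mul_assoc, ← Real.exp_add]
  have hre : (Real.pi * A 2 τ / 2).re = Real.pi / 2 * (A 2 τ).re := by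
    have : (Real.pi * A 2 τ / 2) = ((Real.pi / 2 : ℝ) : ℂ) * A 2 τ := by push_cast; ring
    rw [this, Complex.re_ofReal_mul]
  rw [hre]
  gcongr
  have := h.A_two_re
  have hp : 0 ≤ Real.pi * y ^ 2 := by positivity
  nlinarith

lemma localIntegrand_of_abs_le {y : ℝ} (hτ1 : τ ≤ 1) (hy : |τ * y| ≤ 1 / 2) :
    amp (q₁ τ + eps * ((τ * y : ℝ) : ℂ) / (τ : ℂ) ^ 2)
      * Complex.exp (phase τ (q₁ τ + eps * ((τ * y : ℝ) : ℂ) / (τ : ℂ) ^ 2) - phase τ (q₁ τ)) =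
    seriesValue (ampSeriesAt τ y) τ * Complex.exp (seriesValue (phaseSeriesAt τ y) τ)
      * Complex.exp (-(Real.pi * A 2 τ / 2) * (y : ℂ) ^ 2) := by
  rw [h.phase_eq_series hy, h.amp_eq_series hy hτ1, Complex.exp_add]
  ring

lemma norm_localIntegrand_le (hτ1 : τ ≤ 1) (y : ℝ) :
    ‖localIntegrand τ y‖ ≤ ampMajorant * Real.exp (-(Real.pi * (9 / 200)) * y ^ 2) := by
  have hM := ampMajorant_nonneg
  rw [localIntegrand, Set.indicator_apply]
  split_ifs with hy
  · have hy' : |τ * y| ≤ 1 / 2 := by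
      have hpos := h.pos
      have : |y| ≤ 1 / (2 * τ) := abs_le.2 ⟨hy.1.le, hy.2⟩
      rw [abs_mul, abs_of_pos h.pos]
      rw [le_div_iff₀ (by positivity)] at this
      linarith
    have hyr : |y| * τ ≤ 1 / 2 := by rwa [abs_mul, abs_of_pos h.pos, mul_comm] at hy'
    rw [h.localIntegrand_of_abs_le hτ1 hy', norm_mul]
    refine le_trans ?_ (h.gaussian_decay y hM)
    -- Order `N = 0` at radius `r = τ`: the remainder is the whole function.
    have := norm_mul_exp_sub_le (constantCoeff_phaseSeriesAt τ y) h.pos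
      (h.weightedBound_ampSeriesAt h.pos.le hτ1 hyr) (h.weightedBound_phaseSeriesAt h.pos.le hyr)
      h.pos.le le_rfl 0
    simp only [Finset.range_zero, Finset.sum_empty, sub_zero, pow_zero, one_mul] at this
    gcongr
  · simp only [norm_zero]
    positivity

lemma integrable_localIntegrand (hτ1 : τ ≤ 1) : MeasureTheory.Integrable (localIntegrand τ) :=
  ((integrable_exp_neg_mul_sq (by positivity : 0 < Real.pi * (9 / 200))).const_mul
    ampMajorant).mono' (measurable_localIntegrand τ).aestronglyMeasurable
    (Eventually.of_forall (h.norm_localIntegrand_le hτ1))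

theorem norm_localIntegrand_sub_le (hτ1 : τ ≤ 1) (N : ℕ) (y : ℝ) :
    ‖localIntegrand τ y - gaussianApprox τ N y‖ ≤ 2 * ampMajorant * (2 * τ) ^ N *
      ((1 + |y|) ^ N * Real.exp (-(Real.pi * (9 / 200)) * y ^ 2)) := by
  have hpos := h.pos
  have hy0 := abs_nonneg y
  have hM := ampMajorant_nonneg
  -- This radius meets `r ≤ 1` and `|y| r ≤ 1/2` for every `y`, and `1 / r` grows only linearly in
  -- `|y|`, so `(τ / r)^N` is integrable against the Gaussian.
  set r : ℝ := 1 / (2 * (1 + |y|)) with hr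
  have hr0 : 0 < r := by positivity
  have hr1 : r ≤ 1 := by
    rw [hr, div_le_one (by positivity)]; linarith
  have hyr : |y| * r ≤ 1 / 2 := by
    rw [hr, mul_one_div, div_le_iff₀ (by positivity)]; linarith
  have ha := h.weightedBound_ampSeriesAt hr0.le hr1 hyr
  have hh := h.weightedBound_phaseSeriesAt hr0.le hyr
  have h0 := constantCoeff_phaseSeriesAt τ y
  have hdec := h.gaussian_decay y hM
  have hτr : (2 * τ) ^ N * (1 + |y|) ^ N = (τ / r) ^ N := by
    rw [← mul_pow, hr]; congr 1; field_simp
  have hrhs : 2 * ampMajorant * (2 * τ) ^ N *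
      ((1 + |y|) ^ N * Real.exp (-(Real.pi * (9 / 200)) * y ^ 2)) =
      2 * ((τ / r) ^ N * (ampMajorant * Real.exp (-(Real.pi * (9 / 200)) * y ^ 2))) := by
    rw [← hτr]; ring
  rw [hrhs]
  have hX : 0 ≤ ampMajorant * Real.exp (-(Real.pi * (9 / 200)) * y ^ 2) := by positivity
  have hpw : 0 ≤ (τ / r) ^ N := by positivity
  simp only [gaussianApprox, eval_expansionCoeff]
  rcases le_or_gt τ r with hle | hlt
  · have hy' : |τ * y| ≤ 1 / 2 := by
      rw [abs_mul, abs_of_pos hpos, mul_comm]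
      exact (mul_le_mul_of_nonneg_left hle hy0).trans hyr
    -- For `τ ≤ r` the point lies strictly inside the segment. Points beyond its ends therefore fall
    -- under `τ > r`, and cutting off the Gaussian needs no separate estimate.
    have hmem : y ∈ Set.Ioc (-(1 / (2 * τ))) (1 / (2 * τ)) := by
      have hlt : |y| < 1 / (2 * τ) := by
        rw [lt_div_iff₀ (by positivity)]
        have h2 : τ * (2 * (1 + |y|)) ≤ 1 := by
          rwa [hr, le_div_iff₀ (by positivity)] at hle
        linarith
      exact ⟨(abs_lt.1 hlt).1, (abs_lt.1 hlt).2.le⟩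
    rw [localIntegrand, Set.indicator_of_mem hmem, h.localIntegrand_of_abs_le hτ1 hy', ← sub_mul,
      norm_mul]
    have h1 := norm_mul_exp_sub_le h0 hr0 ha hh hpos.le hle N
    calc _ ≤ (τ / r) ^ N * (ampMajorant * Real.exp (Real.pi * (43 / 100) * y ^ 2))
          * ‖Complex.exp (-(Real.pi * A 2 τ / 2) * (y : ℂ) ^ 2)‖ := by gcongr
      _ = (τ / r) ^ N * (ampMajorant * Real.exp (Real.pi * (43 / 100) * y ^ 2)
          * ‖Complex.exp (-(Real.pi * A 2 τ / 2) * (y : ℂ) ^ 2)‖) := by ring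
      _ ≤ (τ / r) ^ N * (ampMajorant * Real.exp (-(Real.pi * (9 / 200)) * y ^ 2)) := by gcongr
      _ ≤ _ := by linarith [mul_nonneg hpw hX]
  · have h1 := norm_sum_mulExpCoeff_le h0 hr0 ha hh hlt.le N
    have h2 := h.norm_localIntegrand_le hτ1 y
    have hone : 1 ≤ (τ / r) ^ N := one_le_pow₀ ((one_le_div hr0).2 hlt.le)
    refine (norm_sub_le _ _).trans ?_
    rw [two_mul]
    refine add_le_add (h2.trans (le_mul_of_one_le_left hX hone)) ?_
    rw [norm_mul]
    calc _ ≤ (τ / r) ^ N * (ampMajorant * Real.exp (Real.pi * (43 / 100) * y ^ 2))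
          * ‖Complex.exp (-(Real.pi * A 2 τ / 2) * (y : ℂ) ^ 2)‖ := by gcongr
      _ = (τ / r) ^ N * (ampMajorant * Real.exp (Real.pi * (43 / 100) * y ^ 2)
          * ‖Complex.exp (-(Real.pi * A 2 τ / 2) * (y : ℂ) ^ 2)‖) := by ring
      _ ≤ _ := by gcongr

lemma A_two_re_pos : 0 < (A 2 τ).re := lt_of_lt_of_le (by norm_num) h.A_two_re

lemma integrable_gaussianApprox (N : ℕ) : MeasureTheory.Integrable (gaussianApprox τ N) := by
  simp_rw [funext (gaussianApprox_eq τ N)]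
  exact integrable_polynomial_mul_cexp (re_gaussian_pos h.A_two_re_pos) _

lemma integral_gaussianApprox (N : ℕ) : ∫ y, gaussianApprox τ N y =
    (∑ m ∈ Finset.range N, Fcoeff m τ * (τ : ℂ) ^ m)
      * (Real.sqrt 2 / A 2 τ ^ (1 / 2 : ℂ)) := by
  have hb := re_gaussian_pos h.A_two_re_pos
  have e : ∀ y : ℝ, gaussianApprox τ N y = ∑ m ∈ Finset.range N, (τ : ℂ) ^ m *
      ((expansionCoeff τ m).eval (y : ℂ)
        * Complex.exp (-(Real.pi * A 2 τ / 2) * (y : ℂ) ^ 2)) := by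
    intro y
    rw [gaussianApprox, Finset.sum_mul]
    exact Finset.sum_congr rfl fun m _ => by ring
  simp_rw [e]
  rw [MeasureTheory.integral_finsetSum _ fun m _ =>
    (integrable_polynomial_mul_cexp hb (expansionCoeff τ m)).const_mul _, Finset.sum_mul]
  refine Finset.sum_congr rfl fun m _ => ?_
  rw [MeasureTheory.integral_const_mul, integral_polynomial_mul_cexp h.A_two_re_pos, Fcoeff_eq]
  ring

end NearSaddle

theorem J₄_expansion (N : ℕ) :
    (fun τ : ℝ => J₄ τ - prefactor τ * ∑ m ∈ Finset.range N, Fcoeff m τ * (τ : ℂ) ^ m)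
      =O[𝓝[>] 0] fun τ : ℝ => τ ^ ((N : ℝ) - 3 / 2) := by
  set K : ℝ := ∫ y : ℝ, (1 + |y|) ^ N * Real.exp (-(Real.pi * (9 / 200)) * y ^ 2) with hK
  have hE : Tendsto (fun τ => ‖E τ‖) (𝓝[>] 0) (𝓝 1) := by
    simpa using (tendsto_of_isPowerSeriesNearZero E_isPowerSeriesNearZero).norm
  refine IsBigO.of_bound (2 * Real.pi * 2 * (2 * ampMajorant * 2 ^ N * K)) ?_
  filter_upwards [eventually_nearSaddle, Ioo_mem_nhdsGT (show (0 : ℝ) < 1 by norm_num),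
    hE.eventually_le_const (show (1 : ℝ) < 2 by norm_num)] with τ h hτ hE2
  have hτ1 : τ ≤ 1 := hτ.2.le
  have hint := integrable_one_add_abs_pow_mul_exp (by positivity : 0 < Real.pi * (9 / 200)) N
  have e : J₄ τ - prefactor τ * ∑ m ∈ Finset.range N, Fcoeff m τ * (τ : ℂ) ^ m =
      saddleFactor τ * ∫ y, (localIntegrand τ y - gaussianApprox τ N y) := by
    rw [MeasureTheory.integral_sub (h.integrable_localIntegrand hτ1)
      (h.integrable_gaussianApprox N), h.integral_gaussianApprox N, J₄_eq h.pos,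
      prefactor_eq h.pos]
    ring
  have hI : ‖∫ y, (localIntegrand τ y - gaussianApprox τ N y)‖ ≤
      2 * ampMajorant * (2 * τ) ^ N * K := by
    rw [hK, ← MeasureTheory.integral_const_mul]
    exact MeasureTheory.norm_integral_le_of_norm_le (hint.const_mul _)
      (Eventually.of_forall (h.norm_localIntegrand_sub_le hτ1 N))
  have hpos := h.pos
  have hrp : ‖τ ^ ((N : ℝ) - 3 / 2)‖ = τ ^ N * τ ^ (-(3 / 2) : ℝ) := by
    rw [Real.norm_of_nonneg (by positivity), sub_eq_add_neg, Real.rpow_add hpos,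
      Real.rpow_natCast]
  -- The factor `τ^(-3/2)` combines `1/τ` from `dz` with `τ^(-1/2)` from `exp (φ(q₁))`; the
  -- oscillating exponential has modulus `1`.
  rw [e, norm_mul, norm_saddleFactor hpos, hrp]
  calc _ ≤ 2 * Real.pi * τ ^ (-(3 / 2) : ℝ) * 2 * (2 * ampMajorant * (2 * τ) ^ N * K) := by
        gcongr
    _ = _ := by rw [mul_pow]; ring

end SaddleJ

end

theorem mainTheorem2 :
    -- the main saddle is well defined for small `τ`, and is a critical point of the phase
    (∀ᶠ τ : ℝ in 𝓝[>] 0,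
      SaddleJ.IsMainSaddle τ (SaddleJ.q₁ τ) ∧
      (∀ z, SaddleJ.IsMainSaddle τ z → z = SaddleJ.q₁ τ) ∧
      deriv (SaddleJ.phase τ) (SaddleJ.q₁ τ) = 0) ∧
    -- `E` is a convergent power series with the stated first terms
    SaddleJ.IsPowerSeriesNearZero SaddleJ.E 1 ∧
    ((fun τ : ℝ => SaddleJ.E τ -
        (1 + Complex.I * (8 * Real.pi ^ 2 - 1) / (32 * Real.pi) * (τ : ℂ) ^ 2
          + (-(7 / 128) + 13 / (6144 * Real.pi ^ 2) + Complex.I * Real.pi / 4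
              - Real.pi ^ 2 / 32) * (τ : ℂ) ^ 4))
      =O[𝓝[>] 0] fun τ : ℝ => τ ^ 5) ∧
    -- the `A_n` and `B_n` are convergent power series with constant term `1`
    (∀ n, 2 ≤ n → SaddleJ.IsPowerSeriesNearZero (SaddleJ.A n) 1) ∧
    (∀ n, SaddleJ.IsPowerSeriesNearZero (SaddleJ.B n) 1) ∧
    -- the `A_n` are the normalised derivatives of the phase at the main saddle
    (∀ᶠ τ : ℝ in 𝓝[>] 0, ∀ n : ℕ, 2 ≤ n →
      SaddleJ.A n τ = iteratedDeriv n (SaddleJ.phase τ) (SaddleJ.q₁ τ) /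
        (Real.pi * (Complex.I * (τ : ℂ) ^ 2) ^ (n - 1) * ((n - 1).factorial : ℂ))) ∧
    -- the first terms of `A₂`
    ((fun τ : ℝ => SaddleJ.A 2 τ -
        (1 + Complex.I / (4 * Real.pi) * (τ : ℂ) ^ 2 - 1 / (16 * Real.pi ^ 2) * (τ : ℂ) ^ 4
          + (-(1 / 2) - Complex.I / (64 * Real.pi ^ 3)) * (τ : ℂ) ^ 6
          + 1 / 256 * (-400 + 1 / Real.pi ^ 4 - 128 * Complex.I / Real.pi) * (τ : ℂ) ^ 8))
      =O[𝓝[>] 0] fun τ : ℝ => τ ^ 10) ∧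
    -- the first coefficients of `F`
    (∀ τ : ℝ, 0 < τ →
      SaddleJ.Fcoeff 0 τ = 1 ∧
      SaddleJ.Fcoeff 1 τ = 0 ∧
      SaddleJ.Fcoeff 2 τ =
        3 * Complex.I * SaddleJ.A 4 τ / (4 * Real.pi * SaddleJ.A 2 τ ^ 2)
          - 5 * Complex.I * SaddleJ.A 3 τ ^ 2 / (6 * Real.pi * SaddleJ.A 2 τ ^ 3) ∧
      SaddleJ.Fcoeff 3 τ = 0 ∧
      SaddleJ.Fcoeff 4 τ =
        -(385 * SaddleJ.A 3 τ ^ 4 / (72 * Real.pi ^ 2 * SaddleJ.A 2 τ ^ 6))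
          + 105 * SaddleJ.A 4 τ * SaddleJ.A 3 τ ^ 2 / (8 * Real.pi ^ 2 * SaddleJ.A 2 τ ^ 5)
          - 7 * SaddleJ.A 5 τ * SaddleJ.A 3 τ / (Real.pi ^ 2 * SaddleJ.A 2 τ ^ 4)
          - 105 * SaddleJ.A 4 τ ^ 2 / (32 * Real.pi ^ 2 * SaddleJ.A 2 τ ^ 4)
          + 5 * SaddleJ.A 6 τ / (2 * Real.pi ^ 2 * SaddleJ.A 2 τ ^ 3) ∧
      SaddleJ.Fcoeff 5 τ = SaddleJ.eps ^ 3 / 4 * SaddleJ.B 0 τ) ∧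
    -- the generalised asymptotic expansion of `J₄`, to every order
    (∀ N : ℕ,
      (fun τ : ℝ => SaddleJ.J₄ τ -
          SaddleJ.prefactor τ *
            ∑ m ∈ Finset.range N, SaddleJ.Fcoeff m τ * (τ : ℂ) ^ m)
        =O[𝓝[>] 0] fun τ : ℝ => τ ^ ((N : ℝ) - 3 / 2)) := by
  refine ⟨?_, SaddleJ.E_isPowerSeriesNearZero, SaddleJ.E_expansion,
    fun n _ => SaddleJ.A_isPowerSeriesNearZero n, SaddleJ.B_isPowerSeriesNearZero,
    SaddleJ.A_eq_iteratedDeriv, SaddleJ.A_two_expansion, fun τ _ => ⟨?_, ?_, SaddleJ.Fcoeff_two τ,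
      ?_, SaddleJ.Fcoeff_four τ, SaddleJ.Fcoeff_five τ⟩, SaddleJ.J₄_expansion⟩
  · filter_upwards [SaddleJ.isMainSaddle_q₁, SaddleJ.deriv_phase_q₁] with τ h h'
    exact ⟨h.1, h.2, h'⟩
  · rw [SaddleJ.Fcoeff_of_lt_five τ (by norm_num), SaddleJ.phaseMoment_zero]
  · rw [SaddleJ.Fcoeff_of_lt_five τ (by norm_num), SaddleJ.phaseMoment_odd τ 1 odd_one]
  · rw [SaddleJ.Fcoeff_of_lt_five τ (by norm_num), SaddleJ.phaseMoment_odd τ 3 (by decide)]
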